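/- Let $K$ be a field, let $r\ge 1$ and $n_1,\dots,n_r\ge 1$ be integers, put $N=n_1+\cdots+n_r$ and $S=K[x_1,\dots,x_N]$ with the standard grading, and let $$I=I_{n_1,\dots,n_r}=(x_1,\dots,x_{n_1})\cap(x_{n_1+1},\dots,x_{n_1+n_2})\cap\cdots\cap(x_{n_1+\cdots+n_{r-1}+1},\dots,x_N)\subset S .$$ For a finitely generated graded $S$-module $M$ let $\operatorname{hdepth}(M)$, the Hilbert depth of $M$, be the maximal depth of a finitely generated graded $S$-module with the same Hilbert series as $M$. For $x\in\mathbb Z$ and an integer $k\ge 0$ let $\binom{x}{k}=x(x-1)\cdots(x-k+1)/k!$, and write $[r]=\{1,\dots,r\}$. Then $$\begin{aligned}(1)\quad \operatorname{hdepth}(I)=\max\Big\{d\in\mathbb Z\;:\;&\sum_{i=1}^r\Big\lceil\frac{n_i}{2}\Big\rceil\le d\le\Big\lfloor\frac{N+r}{2}\Big\rfloor\ \text{ and }\\ &\sum_{J\subseteq[r]}(-1)^{|J|}\binom{N-\sum_{i\in J}n_i-d+k-1}{k}\ge 0\ \text{ for all } r\le k\le d\Big\},\end{aligned}$$ $$\begin{aligned}(2)\quad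 \operatorname{hdepth}(S/I)=\max\Big\{d\in\mathbb Z\;:\;&\sum_{i=1}^r\Big\lceil\frac{n_i}{2}\Big\rceil-\min_{1\le i\le r}\Big\lceil\frac{n_i}{2}\Big\rceil\le d\le N-\min_{1\le i\le r}n_i\ \text{ and }\\ &\sum_{\emptyset\ne J\subseteq[r]}(-1)^{|J|+1}\binom{N-\sum_{i\in J}n_i-d+k-1}{k}\ge 0\ \text{ for all } r\le k\le d\Big\}.\end{aligned}$$ In particular, both sets are nonempty, so that the maxima exist. -/

import Mathlib

open MvPolynomial

universe u

namespace HilbertDepth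

/-- The standard `ℤ`-grading of the polynomial ring `S = K[x_v : v ∈ σ]`: the piece of degree `k`
is the space of homogeneous polynomials of degree `k` (it is zero for `k < 0`). -/
noncomputable abbrev stdGrading (K : Type u) [Field K] (σ : Type) :
    ℤ → Submodule K (MvPolynomial σ K) :=
  weightedHomogeneousSubmodule K (fun _ : σ => (1 : ℤ))

/-- `ℳ` is a grading of the `S`-module `M`: `M` is the direct sum of the `K`-subspaces `ℳ k`,
`k ∈ ℤ`, and `S_i ℳ_j ⊆ ℳ_{i+j}`. -/
structure IsGrading {K : Type u} [Field K] {σ : Type} {M : Type u} [AddCommGroup M]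
    [Module K M] [Module (MvPolynomial σ K) M] (ℳ : ℤ → Submodule K M) : Prop where
  isInternal : DirectSum.IsInternal ℳ
  smul_mem : ∀ (i j : ℤ) (f : MvPolynomial σ K) (m : M),
    f ∈ stdGrading K σ i → m ∈ ℳ j → f • m ∈ ℳ (i + j)

/-- The depth of an `S`-module `M`: the supremum of the lengths of the `M`-regular sequences
with entries in the graded maximal ideal `(x_v : v ∈ σ)`. -/
noncomputable def moduleDepth (K : Type u) [Field K] (σ : Type) (M : Type u) [AddCommGroup M]
    [Module (MvPolynomial σ K) M] : ℕ∞ :=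
  ⨆ (rs : List (MvPolynomial σ K))
    (_ : (∀ f ∈ rs, f ∈ Ideal.span (Set.range (X : σ → MvPolynomial σ K))) ∧
      RingTheory.Sequence.IsRegular M rs), (rs.length : ℕ∞)

/-- The Hilbert depth of an `S`-module with grading `ℳ` (all graded pieces finite-dimensional):
the largest depth of a finitely generated graded `S`-module `N` with the same Hilbert series,
i.e. with `dim_K N_k = dim_K ℳ_k` for all `k ∈ ℤ`. -/
noncomputable def hdepth {K : Type u} [Field K] (σ : Type) {M : Type u} [AddCommGroup M]
    [Module K M] (ℳ : ℤ → Submodule K M) : ℕ∞ :=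
  sSup {e : ℕ∞ | ∃ (N : Type u) (_ : AddCommGroup N) (_ : Module K N)
    (_ : Module (MvPolynomial σ K) N) (_ : IsScalarTower K (MvPolynomial σ K) N)
    (𝒩 : ℤ → Submodule K N),
      Module.Finite (MvPolynomial σ K) N ∧ IsGrading (σ := σ) 𝒩 ∧
      (∀ k : ℤ, Module.finrank K (𝒩 k) = Module.finrank K (ℳ k)) ∧
      e = moduleDepth K σ N}

/-- The grading of an ideal `I` of `S` by the subspaces `I ∩ S_k`. -/
noncomputable def idealGrading {K : Type u} [Field K] {σ : Type}
    (I : Ideal (MvPolynomial σ K)) (k : ℤ) : Submodule K I :=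
  (stdGrading K σ k).comap (I.subtype.restrictScalars K)

/-- The grading of `S/I` by the images of the `S_k`. -/
noncomputable def quotientGrading {K : Type u} [Field K] {σ : Type}
    (I : Ideal (MvPolynomial σ K)) (k : ℤ) : Submodule K (MvPolynomial σ K ⧸ I) :=
  (stdGrading K σ k).map (Ideal.Quotient.mkₐ K I).toLinearMap

/-- The ideal `I_{n_1,…,n_r}`: the variables come in `r` disjoint blocks, the `i`-th one being
`x_⟨i,0⟩, …, x_⟨i,n_i-1⟩`, and the ideal is the intersection of the `r` prime ideals generated by
the blocks. -/
noncomputable def blockIdeal (K : Type u) [Field K] {r : ℕ} (n : Fin r → ℕ) :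
    Ideal (MvPolynomial (Σ i : Fin r, Fin (n i)) K) :=
  ⨅ i : Fin r, Ideal.span (Set.range fun j : Fin (n i) => X ⟨i, j⟩)

/-- The sum `∑_J (-1)^|J| C(N - ∑_{i ∈ J} n_i - d + k - 1, k)` over all `J ⊆ {1,…,r}`, where
`N = n_1 + ⋯ + n_r` and `C(x,k) = x(x-1)⋯(x-k+1)/k!` for every integer `x`. -/
def idealSum {r : ℕ} (n : Fin r → ℕ) (d k : ℕ) : ℤ :=
  ∑ J : Finset (Fin r), (-1) ^ J.card *
    Ring.choose ((∑ i, (n i : ℤ)) - (∑ i ∈ J, (n i : ℤ)) - d + k - 1) k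

/-- The sum `∑_J (-1)^(|J|+1) C(N - ∑_{i ∈ J} n_i - d + k - 1, k)` over all nonempty
`J ⊆ {1,…,r}`. -/
def quotientSum {r : ℕ} (n : Fin r → ℕ) (d k : ℕ) : ℤ :=
  ∑ J : Finset (Fin r) with J.Nonempty, (-1) ^ (J.card + 1) *
    Ring.choose ((∑ i, (n i : ℤ)) - (∑ i ∈ J, (n i : ℤ)) - d + k - 1) k

end HilbertDepth

/-! Write `negPow x` for (1 - X)^(-x). Inclusion–exclusion over the blocks gives the Hilbert series
∏ (negPow n_i - 1) for I, and ∏ negPow n_i minus this product for S/I. The alternating sums in the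
statement are the coefficients of (1 - X)^d φ, for φ the relevant series. The claim is that the
Hilbert depth is the largest d for which (1 - X)^d φ has no negative coefficient, and that the
degrees r ≤ k ≤ d decide this once d lies in the stated range.

Depth bounds d: regular sequences need not be homogeneous, so the field is first enlarged to an
infinite one (`IsProjectionFamily.diff_iterate_nonneg`), where a regular linear form exists.
Dividing by such a form multiplies the Hilbert series by 1 - X. By the exchange theorem
`HasWeaklyRegular.quotSMulTop` the quotient still has a weakly regular sequence that is one shorter,
so d steps show that (1 - X)^d φ is a Hilbert series.

Nonnegativity is attained: if (1 - X)^d φ is a finite sum of terms X^s (1 - X)^(-j) with j ≤ N - d,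
then φ is the series of a direct sum of shifted polynomial rings in d + j variables, on which the
first d variables form a regular sequence (`isRealizable_of_decomposable`). Such a sum exists as
soon as the coefficients in degrees at most d are nonnegative, because the part in degrees above d
always decomposes (`tail_ideal_mem`, `tail_quotient_mem`).

The lower ends of the ranges come from splitting each n_i into halves (`idealSeries_nonneg`,
`quotientSeries_nonneg`), the upper ends from one well-chosen coefficient
(`le_of_idealSeries_nonneg`, `le_of_quotientSeries_nonneg`). -/

namespace HilbertDepth

/-! ### Integer powers of 1 - X -/

/-- The power series `(1 - X)^(-x)` for an integer `x`. -/
noncomputable def negPow (x : ℤ) : PowerSeries ℤ := PowerSeries.mk fun k => Ring.multichoose x k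

@[simp] lemma coeff_negPow (x : ℤ) (k : ℕ) :
    PowerSeries.coeff k (negPow x) = Ring.multichoose x k := by simp [negPow]

@[simp] lemma negPow_zero : negPow 0 = 1 := by
  ext k
  rw [coeff_negPow, PowerSeries.coeff_one]
  cases k <;> simp

lemma negPow_add_one (x : ℤ) : negPow (x + 1) = negPow x + PowerSeries.X * negPow (x + 1) := by
  ext k
  rw [map_add, coeff_negPow, coeff_negPow]
  cases k with
  | zero => simp
  | succ k => simp [PowerSeries.coeff_succ_X_mul, Ring.multichoose_succ_succ]

lemma one_sub_X_mul_negPow (x : ℤ) : (1 - PowerSeries.X) * negPow (x + 1) = negPow x := by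
  linear_combination negPow_add_one x

lemma one_sub_X_ne_zero : (1 - PowerSeries.X : PowerSeries ℤ) ≠ 0 := by
  intro h
  simpa using congrArg (PowerSeries.coeff 0) h

lemma negPow_add (x y : ℤ) : negPow (x + y) = negPow x * negPow y := by
  induction y using Int.induction_on with
  | zero => simp
  | succ i ih =>
    apply mul_left_cancel₀ one_sub_X_ne_zero
    rw [mul_left_comm, one_sub_X_mul_negPow, ← ih, ← add_assoc, one_sub_X_mul_negPow]
  | pred i ih =>
    have h1 := one_sub_X_mul_negPow (-(i : ℤ) - 1)
    have h2 := one_sub_X_mul_negPow (x + (-(i : ℤ) - 1))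
    rw [sub_add_cancel] at h1
    rw [show x + (-(i : ℤ) - 1) + 1 = x + -i by ring, ih] at h2
    rw [← h1, ← h2]
    ring

lemma negPow_sum {ι : Type*} (T : Finset ι) (f : ι → ℤ) :
    negPow (∑ i ∈ T, f i) = ∏ i ∈ T, negPow (f i) := by
  classical
  induction T using Finset.induction_on with
  | empty => simp
  | insert a s ha ih => rw [Finset.sum_insert ha, Finset.prod_insert ha, negPow_add, ih]

lemma negPow_neg_natCast (n : ℕ) : negPow (-n) = (1 - PowerSeries.X) ^ n := by
  have h : negPow (-1) = 1 - PowerSeries.X := by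
    have := one_sub_X_mul_negPow (-1)
    simpa using this.symm
  simpa [h] using negPow_sum (Finset.range n) (fun _ => -1)

lemma multichoose_neg_natCast (n k : ℕ) :
    Ring.multichoose (-n : ℤ) k = (-1) ^ k * (n.choose k : ℤ) := by
  have h := Ring.choose_neg (-n : ℤ) k
  rw [neg_neg, Ring.choose_natCast] at h
  rw [Ring.multichoose_eq, h, Int.negOnePow_def]
  rcases Nat.even_or_odd k with hk | hk <;> simp [hk]

lemma multichoose_natCast (n k : ℕ) :
    Ring.multichoose (n : ℤ) k = (n.multichoose k : ℤ) := by
  cases n with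
  | zero => cases k <;> simp
  | succ n =>
    rw [Ring.multichoose_eq, Nat.multichoose_eq, ← Ring.choose_natCast]
    congr 1
    push_cast [show n + 1 + k - 1 = n + k by omega]
    ring

lemma negPow_sub_one (n : ℕ) :
    negPow n - 1 = ∑ j ∈ Finset.range n, PowerSeries.X * negPow (j + 1) := by
  have : ∀ j ∈ Finset.range n, PowerSeries.X * negPow ((j : ℤ) + 1)
      = negPow ((j + 1 : ℕ) : ℤ) - negPow (j : ℕ) := by
    intro j _
    push_cast
    linear_combination - negPow_add_one j
  rw [Finset.sum_congr rfl this, Finset.sum_range_sub (fun j => negPow (j : ℤ))]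
  simp

/-! ### Nonnegative and decomposable series -/

/-- The semiring of integral power series with nonnegative coefficients. -/
def nonnegSeries : Subsemiring (PowerSeries ℤ) where
  carrier := {φ | ∀ k, 0 ≤ PowerSeries.coeff k φ}
  zero_mem' := by simp
  one_mem' k := by rw [PowerSeries.coeff_one]; split_ifs <;> simp
  add_mem' ha hb k := by simpa using add_nonneg (ha k) (hb k)
  mul_mem' ha hb k := by
    rw [PowerSeries.coeff_mul]
    exact Finset.sum_nonneg fun p _ => mul_nonneg (ha _) (hb _)

lemma X_mem_nonnegSeries : (PowerSeries.X : PowerSeries ℤ) ∈ nonnegSeries := by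
  intro k
  rw [PowerSeries.coeff_X]
  split_ifs <;> simp

lemma negPow_natCast_mem (n : ℕ) : negPow n ∈ nonnegSeries := by
  intro k
  simp [multichoose_natCast]

/-- The series that are finite sums of series `X^s (1 - X)^(-j)` with `j ≤ m`. -/
noncomputable def decomposable (m : ℕ) : AddSubmonoid (PowerSeries ℤ) :=
  AddSubmonoid.closure {φ | ∃ s j : ℕ, j ≤ m ∧ φ = PowerSeries.X ^ s * negPow j}

lemma X_pow_mul_negPow_mem {m j : ℕ} (s : ℕ) (h : j ≤ m) :
    PowerSeries.X ^ s * negPow j ∈ decomposable m :=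
  AddSubmonoid.subset_closure ⟨s, j, h, rfl⟩

lemma decomposable_le (m : ℕ) : decomposable m ≤ nonnegSeries.toAddSubmonoid := by
  refine (AddSubmonoid.closure_le).2 ?_
  rintro _ ⟨s, j, -, rfl⟩
  exact nonnegSeries.mul_mem (pow_mem X_mem_nonnegSeries s) (negPow_natCast_mem j)

/-- The part of a power series in degrees at least `L`. -/
noncomputable def tail (L : ℕ) : PowerSeries ℤ →+ PowerSeries ℤ where
  toFun φ := PowerSeries.mk fun k => if k < L then 0 else PowerSeries.coeff k φ
  map_zero' := by ext; simp
  map_add' a b := by ext k; simp only [PowerSeries.coeff_mk, map_add]; split_ifs <;> simp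

lemma coeff_tail (L k : ℕ) (φ : PowerSeries ℤ) :
    PowerSeries.coeff k (tail L φ) = if k < L then 0 else PowerSeries.coeff k φ := by
  simp [tail]

lemma tail_eq_zero {L : ℕ} {φ : PowerSeries ℤ} (h : ∀ k, L ≤ k → PowerSeries.coeff k φ = 0) :
    tail L φ = 0 := by
  ext k
  rw [coeff_tail]
  split_ifs with hk
  · simp
  · simp [h k (not_lt.1 hk)]

/-- Split X^s (1 - X)^(-(j+1)) as X^s (1 - X)^(-j) + X^(s+1) (1 - X)^(-(j+1)). The first term has a
smaller exponent, and repeating this on the second raises s to L, where truncation changes nothing.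
-/
lemma tail_X_pow_mul_negPow_mem {m j : ℕ} (L s : ℕ) (hj : j ≤ m) :
    tail L (PowerSeries.X ^ s * negPow j) ∈ decomposable m := by
  induction j generalizing s with
  | zero =>
    rcases lt_or_ge s L with h | h
    · rw [tail_eq_zero]
      · exact zero_mem _
      · intro k hk
        simp [PowerSeries.coeff_X_pow, (h.trans_le hk).ne']
    · have : tail L (PowerSeries.X ^ s * negPow ((0 : ℕ) : ℤ))
          = PowerSeries.X ^ s * negPow ((0 : ℕ) : ℤ) := by
        ext k
        rw [coeff_tail]
        split_ifs with hk
        · simp [PowerSeries.coeff_X_pow, (hk.trans_le h).ne]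
        · rfl
      rw [this]
      exact X_pow_mul_negPow_mem s hj
  | succ j ih =>
    obtain ⟨t, ht⟩ : ∃ t, L ≤ s + t := ⟨L, by omega⟩
    induction t generalizing s with
    | zero =>
      have : tail L (PowerSeries.X ^ s * negPow ((j + 1 : ℕ) : ℤ))
          = PowerSeries.X ^ s * negPow ((j + 1 : ℕ) : ℤ) := by
        ext k
        rw [coeff_tail]
        split_ifs with hk
        · rw [PowerSeries.coeff_X_pow_mul', if_neg (by omega)]
        · rfl
      rw [this]
      exact X_pow_mul_negPow_mem s hj
    | succ t iht =>
      have : PowerSeries.X ^ s * negPow ((j + 1 : ℕ) : ℤ)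
          = PowerSeries.X ^ s * negPow j + PowerSeries.X ^ (s + 1) * negPow ((j + 1 : ℕ) : ℤ) := by
        push_cast
        linear_combination PowerSeries.X ^ s * negPow_add_one j
      rw [this, map_add]
      exact add_mem (ih s (by omega)) (iht (s + 1) (by omega))

/-- Below degree L, a nonnegative coefficient c in degree k contributes c copies of X^k, the case j
= 0. -/
lemma mem_decomposable_of_tail {m L : ℕ} {φ : PowerSeries ℤ}
    (h : ∀ k < L, 0 ≤ PowerSeries.coeff k φ) (ht : tail L φ ∈ decomposable m) :
    φ ∈ decomposable m := by
  have : φ = ∑ k ∈ Finset.range L, (PowerSeries.coeff k φ).toNat • (PowerSeries.X ^ k * negPow (0 : ℕ))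
      + tail L φ := by
    ext k
    rw [map_add, map_sum, coeff_tail]
    have hc : ∀ l : ℕ, PowerSeries.coeff k ((PowerSeries.coeff l φ).toNat •
        (PowerSeries.X ^ l * negPow (0 : ℕ))) =
        if k = l then ((PowerSeries.coeff l φ).toNat : ℤ) else 0 := by
      intro l
      rw [map_nsmul, Nat.cast_zero, negPow_zero, mul_one, PowerSeries.coeff_X_pow]
      simp
    simp only [hc, Finset.sum_ite_eq, Finset.mem_range]
    split_ifs with hk
    · simp [h k hk]
    · simp
  rw [this]
  exact add_mem (sum_mem fun k _ => nsmul_mem (X_pow_mul_negPow_mem k (Nat.zero_le m)) _) ht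

/-- For e < 0 the series is a polynomial of degree s - e < L, so nothing survives the truncation. -/
lemma tail_X_pow_mul_negPow_mem' {m L s : ℕ} {e : ℤ} (he : e ≤ m) (hs : s - e < L) :
    tail L (PowerSeries.X ^ s * negPow e) ∈ decomposable m := by
  rcases le_or_gt 0 e with h | h
  · lift e to ℕ using h
    exact tail_X_pow_mul_negPow_mem L s (by exact_mod_cast he)
  · obtain ⟨a, rfl⟩ : ∃ a : ℕ, e = -a := ⟨e.natAbs, by omega⟩
    rw [tail_eq_zero]
    · exact zero_mem _
    · intro k hk
      rw [PowerSeries.coeff_X_pow_mul', if_pos (by omega), coeff_negPow,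
        Ring.multichoose_neg_of_lt _ _ (by omega)]

/-! ### Tails of products over the blocks -/

section blocks

variable {ι : Type*} (n : ι → ℕ)

/-- Each summand X (1 - X)^(-(j+1)) of a factor raises s by 1 and e by at least 1, so s - e never
grows. Since j + 1 ≤ n_a, the bound on e plus the remaining block sizes also persists. -/
lemma tail_ideal_mem {m L : ℕ} (T : Finset ι) (s : ℕ) (e : ℤ) (he : e + ∑ i ∈ T, (n i : ℤ) ≤ m)
    (hs : s - e < L) :
    tail L (PowerSeries.X ^ s * negPow e * ∏ i ∈ T, (negPow (n i) - 1)) ∈ decomposable m := by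
  classical
  induction T using Finset.induction_on generalizing s e with
  | empty => simpa using tail_X_pow_mul_negPow_mem' (by simpa using he) hs
  | insert a T ha ih =>
    rw [Finset.sum_insert ha] at he
    have : PowerSeries.X ^ s * negPow e * ∏ i ∈ insert a T, (negPow (n i) - 1)
        = ∑ j ∈ Finset.range (n a), PowerSeries.X ^ (s + 1) * negPow (e + (j + 1))
          * ∏ i ∈ T, (negPow (n i) - 1) := by
      rw [Finset.prod_insert ha, negPow_sub_one, Finset.sum_mul, Finset.mul_sum]
      refine Finset.sum_congr rfl fun j _ => ?_
      rw [negPow_add e]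
      ring
    rw [this, map_sum]
    refine sum_mem fun j hj => ih _ _ ?_ ?_
    · have := Finset.mem_range.1 hj
      omega
    · push_cast
      omega

/-- Peeling off one block leaves a smaller difference of the same kind plus a product treated in
`tail_ideal_mem`. -/
lemma tail_quotient_mem {m L : ℕ} (T : Finset ι) (s : ℕ) (e : ℤ)
    (he : e + ∑ i ∈ T, (n i : ℤ) ≤ m) (hs : s - e < L) :
    tail L (PowerSeries.X ^ s * negPow e *
      (∏ i ∈ T, negPow (n i) - ∏ i ∈ T, (negPow (n i) - 1))) ∈ decomposable m := by
  classical
  induction T using Finset.induction_on generalizing s e with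
  | empty => simp
  | insert a T ha ih =>
    rw [Finset.sum_insert ha] at he
    have : PowerSeries.X ^ s * negPow e *
        (∏ i ∈ insert a T, negPow (n i) - ∏ i ∈ insert a T, (negPow (n i) - 1))
        = PowerSeries.X ^ s * negPow (e + n a) *
          (∏ i ∈ T, negPow (n i) - ∏ i ∈ T, (negPow (n i) - 1))
          + PowerSeries.X ^ s * negPow e * ∏ i ∈ T, (negPow (n i) - 1) := by
      rw [Finset.prod_insert ha, Finset.prod_insert ha, negPow_add e]
      ring
    rw [this, map_add]
    exact add_mem (ih _ _ (by omega) (by omega)) (tail_ideal_mem n T _ _ (by omega) hs)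

end blocks

/-! ### The two Hilbert series and the bounds on d -/

section series

variable {r : ℕ} (n : Fin r → ℕ)

/-- The Hilbert series of the ideal `I_{n_1,…,n_r}`. -/
noncomputable def idealSeries : PowerSeries ℤ := ∏ i, (negPow (n i) - 1)

/-- The Hilbert series of `S / I_{n_1,…,n_r}`. -/
noncomputable def quotientSeries : PowerSeries ℤ :=
  ∏ i, negPow (n i) - ∏ i, (negPow (n i) - 1)

lemma idealSeries_eq_sum :
    idealSeries n = ∑ J : Finset (Fin r),
      (-1) ^ J.card * negPow ((∑ i, (n i : ℤ)) - ∑ i ∈ J, (n i : ℤ)) := by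
  have h : idealSeries n = ∏ i, (-1 + negPow (n i)) :=
    Finset.prod_congr rfl fun i _ => by ring
  rw [h, Finset.prod_add, Finset.powerset_univ]
  refine Finset.sum_congr rfl fun J _ => ?_
  rw [Finset.prod_const, ← negPow_sum, ← Finset.sum_sdiff (Finset.subset_univ J), add_sub_cancel_right]

lemma coeff_neg_one_pow_mul (c k : ℕ) (φ : PowerSeries ℤ) :
    PowerSeries.coeff k ((-1) ^ c * φ) = (-1) ^ c * PowerSeries.coeff k φ := by
  rcases Nat.even_or_odd c with h | h <;> simp [h.neg_one_pow]

lemma coeff_negPow_mul_idealSeries (d k : ℕ) :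
    PowerSeries.coeff k (negPow (-d) * idealSeries n) = idealSum n d k := by
  rw [idealSeries_eq_sum, Finset.mul_sum, map_sum, idealSum]
  refine Finset.sum_congr rfl fun J _ => ?_
  rw [mul_left_comm, ← negPow_add, coeff_neg_one_pow_mul, coeff_negPow, Ring.multichoose_eq]
  congr 3
  ring

lemma quotientSeries_eq_sum :
    quotientSeries n = ∑ J : Finset (Fin r) with J.Nonempty,
      (-1) ^ (J.card + 1) * negPow ((∑ i, (n i : ℤ)) - ∑ i ∈ J, (n i : ℤ)) := by
  have h := idealSeries_eq_sum n
  rw [← Finset.sum_filter_add_sum_filter_not _ Finset.Nonempty] at h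
  have h2 : (Finset.univ.filter fun J : Finset (Fin r) => ¬ J.Nonempty) = {∅} := by
    ext J
    simp
  rw [h2, Finset.sum_singleton] at h
  rw [quotientSeries, ← negPow_sum, ← idealSeries, h]
  simp only [pow_succ, mul_neg, mul_one, neg_mul, Finset.sum_neg_distrib]
  simp

lemma coeff_negPow_mul_quotientSeries (d k : ℕ) :
    PowerSeries.coeff k (negPow (-d) * quotientSeries n) = quotientSum n d k := by
  rw [quotientSeries_eq_sum, Finset.mul_sum, map_sum, quotientSum]
  refine Finset.sum_congr rfl fun J _ => ?_
  rw [mul_left_comm, ← negPow_add, coeff_neg_one_pow_mul, coeff_negPow, Ring.multichoose_eq]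
  congr 3
  ring

/-- Here s = 0 and e = -d, so the tail argument needs L > d. The cut L = d + 1 leaves exactly the
degrees k ≤ d to be checked. -/
lemma decomposable_idealSeries {d : ℕ} (hd : d ≤ ∑ i, n i)
    (h : ∀ k ≤ d, 0 ≤ idealSum n d k) :
    negPow (-d) * idealSeries n ∈ decomposable (∑ i, n i - d) := by
  refine mem_decomposable_of_tail (L := d + 1) (fun k hk => ?_) ?_
  · rw [coeff_negPow_mul_idealSeries]
    exact h k (by omega)
  · have := tail_ideal_mem n (m := ∑ i, n i - d) (L := d + 1) Finset.univ 0 (-d)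
      (by push_cast [hd]; omega) (by push_cast; omega)
    simpa [idealSeries] using this

lemma decomposable_quotientSeries {d : ℕ} (hd : d ≤ ∑ i, n i)
    (h : ∀ k ≤ d, 0 ≤ quotientSum n d k) :
    negPow (-d) * quotientSeries n ∈ decomposable (∑ i, n i - d) := by
  refine mem_decomposable_of_tail (L := d + 1) (fun k hk => ?_) ?_
  · rw [coeff_negPow_mul_quotientSeries]
    exact h k (by omega)
  · have := tail_quotient_mem n (m := ∑ i, n i - d) (L := d + 1) Finset.univ 0 (-d)
      (by push_cast [hd]; omega) (by push_cast; omega)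
    simpa [quotientSeries] using this

/-- The quotient of `(1 - X)^(-n) - 1` by `X`. -/
noncomputable def geomSeries (n : ℕ) : PowerSeries ℤ := ∑ j ∈ Finset.range n, negPow (j + 1)

lemma negPow_sub_one_eq (n : ℕ) : negPow n - 1 = PowerSeries.X * geomSeries n := by
  rw [negPow_sub_one, geomSeries, Finset.mul_sum]

lemma constantCoeff_geomSeries (n : ℕ) : PowerSeries.coeff 0 (geomSeries n) = n := by
  rw [geomSeries, map_sum]
  simp only [coeff_negPow]
  simp

lemma coeff_one_geomSeries (n : ℕ) : 2 * PowerSeries.coeff 1 (geomSeries n) = n * (n + 1) := by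
  rw [geomSeries, map_sum]
  simp only [coeff_negPow, Ring.multichoose_one_right]
  induction n with
  | zero => simp
  | succ n ih =>
    rw [Finset.sum_range_succ, mul_add, ih]
    push_cast
    ring

lemma idealSeries_eq_X_pow_mul :
    idealSeries n = PowerSeries.X ^ r * ∏ i, geomSeries (n i) := by
  simp [idealSeries, negPow_sub_one_eq, Finset.prod_mul_distrib]

lemma coeff_prod_geomSeries {ι : Type*} (n : ι → ℕ) (T : Finset ι) :
    PowerSeries.coeff 0 (∏ i ∈ T, geomSeries (n i)) = ∏ i ∈ T, (n i : ℤ) ∧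
    2 * PowerSeries.coeff 1 (∏ i ∈ T, geomSeries (n i)) =
      (∏ i ∈ T, (n i : ℤ)) * ∑ i ∈ T, ((n i : ℤ) + 1) := by
  classical
  induction T using Finset.induction_on with
  | empty => simp [PowerSeries.coeff_one]
  | insert a T ha ih =>
    obtain ⟨h0, h1⟩ := ih
    have g0 := constantCoeff_geomSeries (n a)
    have g1 := coeff_one_geomSeries (n a)
    rw [PowerSeries.coeff_zero_eq_constantCoeff_apply] at h0 g0
    rw [Finset.prod_insert ha, Finset.prod_insert ha, Finset.sum_insert ha,
      PowerSeries.coeff_one_mul, PowerSeries.coeff_zero_eq_constantCoeff_apply, map_mul, h0, g0]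
    refine ⟨rfl, ?_⟩
    linear_combination (∏ i ∈ T, (n i : ℤ)) * g1 + (n a : ℤ) * h1

lemma idealSum_eq_zero {d k : ℕ} (hk : k < r) : idealSum n d k = 0 := by
  rw [← coeff_negPow_mul_idealSeries, idealSeries_eq_X_pow_mul, mul_left_comm,
    PowerSeries.coeff_X_pow_mul', if_neg (by omega)]

/-- In the lowest degree r the coefficient is ∏ n_i. Twice the next one is (∏ n_i)(N + r - 2d),
which forces 2d ≤ N + r. -/
lemma le_of_idealSeries_nonneg (hn : ∀ i, 1 ≤ n i) {d : ℕ}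
    (h : negPow (-d) * idealSeries n ∈ nonnegSeries) : d ≤ (∑ i, n i + r) / 2 := by
  have h1 := h (1 + r)
  rw [idealSeries_eq_X_pow_mul, mul_left_comm, PowerSeries.coeff_X_pow_mul, PowerSeries.coeff_one_mul,
    ← PowerSeries.coeff_zero_eq_constantCoeff_apply, ← PowerSeries.coeff_zero_eq_constantCoeff_apply,
    coeff_negPow, coeff_negPow, (coeff_prod_geomSeries n _).1] at h1
  have h2 := (coeff_prod_geomSeries n Finset.univ).2
  have h3 : (0 : ℤ) < ∏ i, (n i : ℤ) := Finset.prod_pos fun i _ => by exact_mod_cast hn i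
  simp only [Ring.multichoose_one_right, Ring.multichoose_zero_right, mul_one] at h1
  have h4 : 0 ≤ (∏ i, (n i : ℤ)) * (∑ i, ((n i : ℤ) + 1) - 2 * d) := by linarith
  have h5 := nonneg_of_mul_nonneg_right h4 h3
  rw [Finset.sum_add_distrib] at h5
  simp only [Finset.sum_const, Finset.card_univ, Fintype.card_fin, nsmul_eq_mul, mul_one] at h5
  have : 2 * d ≤ ∑ i, n i + r := by
    zify
    linarith
  omega

/-- The ideal contributes nothing below degree r, so only the coefficient of (1 - X)^(-(N-d))
remains. -/
lemma quotientSum_nonneg_of_lt {d k : ℕ} (hd : d ≤ ∑ i, n i) (hk : k < r) :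
    0 ≤ quotientSum n d k := by
  rw [← coeff_negPow_mul_quotientSeries, quotientSeries, ← idealSeries, mul_sub, map_sub,
    coeff_negPow_mul_idealSeries, idealSum_eq_zero n hk, sub_zero, ← negPow_sum, ← negPow_add]
  have : -(d : ℤ) + ∑ i, (n i : ℤ) = ((∑ i, n i - d : ℕ) : ℤ) := by
    push_cast [hd]
    ring
  rw [this]
  exact negPow_natCast_mem _ k

/-- If d = e + 1 exceeded the bound, summing the coefficients of (1 - X)^(e+1) φ, the first of which
is 1, would make every coefficient of (1 - X)^e φ positive. But this series is a polynomial. -/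
lemma le_of_quotientSeries_nonneg [NeZero r] {d m : ℕ} (hm : ∀ i, m ≤ n i)
    (h : negPow (-d) * quotientSeries n ∈ nonnegSeries) : d ≤ ∑ i, n i - m := by
  by_contra hlt
  obtain ⟨e, rfl⟩ : ∃ e, d = e + 1 := ⟨d - 1, by omega⟩
  have h0 : PowerSeries.coeff 0 (negPow (-(e + 1 : ℕ)) * quotientSeries n) = 1 := by
    have hz : ∀ x, PowerSeries.constantCoeff (negPow x) = 1 := fun x => by
      rw [← PowerSeries.coeff_zero_eq_constantCoeff_apply, coeff_negPow,
        Ring.multichoose_zero_right]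
    rw [PowerSeries.coeff_zero_eq_constantCoeff_apply, quotientSeries]
    simp only [map_mul, map_sub, map_prod, hz]
    simp [NeZero.ne r]
  have hpos : ∀ k, 1 ≤ quotientSum n e k := by
    intro k
    have h1 : negPow (-e) * quotientSeries n
        = negPow (-(e + 1 : ℕ)) * quotientSeries n * negPow (1 : ℕ) := by
      rw [mul_right_comm, ← negPow_add]
      congr 2
      push_cast
      ring
    rw [← coeff_negPow_mul_quotientSeries, h1, PowerSeries.coeff_mul]
    have hmem : ((0, k) : ℕ × ℕ) ∈ Finset.HasAntidiagonal.antidiagonal k := by simp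
    refine le_trans ?_ (Finset.single_le_sum
      (fun p _ => mul_nonneg (h p.1) (negPow_natCast_mem 1 p.2)) hmem)
    rw [h0, coeff_negPow]
    simp
  -- Since J is nonempty, e ≥ N - ∑_J n_i. Each summand is then a polynomial in X of degree at most
  -- e.
  have hz : quotientSum n e (e + 1) = 0 := by
    refine Finset.sum_eq_zero fun J hJ => ?_
    obtain ⟨i, hi⟩ := (Finset.mem_filter.1 hJ).2
    have hJi : (n i : ℤ) ≤ ∑ i ∈ J, (n i : ℤ) :=
      Finset.single_le_sum (f := fun i => (n i : ℤ)) (fun _ _ => by positivity) hi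
    have hle : ∑ i ∈ J, (n i : ℤ) ≤ ∑ i, (n i : ℤ) :=
      Finset.sum_le_sum_of_subset_of_nonneg (Finset.subset_univ J) fun _ _ _ => by positivity
    have hmi := hm i
    have hN : ∑ i, (n i : ℤ) = ((∑ i, n i : ℕ) : ℤ) := by push_cast; rfl
    obtain ⟨a, ha⟩ : ∃ a : ℕ, (∑ i, (n i : ℤ)) - (∑ i ∈ J, (n i : ℤ)) - e = -(a : ℤ) :=
      ⟨(e - ((∑ i, (n i : ℤ)) - (∑ i ∈ J, (n i : ℤ)))).toNat, by omega⟩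
    rw [← Ring.multichoose_eq, ha, Ring.multichoose_neg_of_lt _ _ (by omega), mul_zero]
  have := hpos (e + 1)
  omega

/-- For k ≥ 2 one has b ≤ a + 1 ≤ a + k - 1; degrees 0 and 1 must be treated separately below. -/
lemma choose_le_multichoose {a b k : ℕ} (h : b ≤ a + 1) (hk : 2 ≤ k) :
    b.choose k ≤ a.multichoose k := by
  rw [Nat.multichoose_eq]
  exact Nat.choose_le_choose k (by omega)

lemma negPow_sub_negPow_neg_mem {a b : ℕ} (h : b ≤ a + 1) :
    negPow a - negPow (-b) ∈ nonnegSeries := by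
  intro k
  rw [map_sub, coeff_negPow, coeff_negPow]
  match k with
  | 0 => simp
  | 1 => simp only [Ring.multichoose_one_right]; omega
  | k + 2 =>
    rw [multichoose_natCast, multichoose_neg_natCast]
    have h1 := choose_le_multichoose (k := k + 2) h (by omega)
    rcases neg_one_pow_eq_or ℤ (k + 2) with h2 | h2 <;> rw [h2] <;> omega

lemma negPow_add_negPow_sub_mem {a b c : ℕ} (h : b ≤ a + 1) :
    negPow a + negPow (c - b) - negPow (-b) ∈ nonnegSeries := by
  rcases le_total b c with hbc | hbc
  · rw [add_sub_right_comm]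
    refine add_mem (negPow_sub_negPow_neg_mem h) ?_
    rw [← Nat.cast_sub hbc]
    exact negPow_natCast_mem _
  · intro k
    rw [show (c : ℤ) - b = -((b - c : ℕ) : ℤ) by push_cast [hbc]; ring, map_sub, map_add,
      coeff_negPow, coeff_negPow, coeff_negPow]
    match k with
    | 0 => simp
    | 1 => simp only [Ring.multichoose_one_right]; omega
    | k + 2 =>
      rw [multichoose_natCast, multichoose_neg_natCast, multichoose_neg_natCast]
      have h1 := choose_le_multichoose (k := k + 2) h (by omega)
      have h2 := Nat.choose_le_choose (k + 2) (show b - c ≤ b by omega)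
      rcases neg_one_pow_eq_or ℤ (k + 2) with h3 | h3 <;> rw [h3] <;> omega

/-- With A_i = `negPow (a i)`, B_i = `negPow (-b i)` and C = `negPow c`, adjoining an index t
multiplies the expression by A_t - B_t and adds C (∏ A_i) B_t. Starting from an index j with b_j
maximal makes the exponent in the added term nonnegative: b_t ≤ b_j ≤ a_j + 1 ≤ c + ∑ a_i. -/
lemma halves_prod_mem {ι : Type*} {a b : ι → ℕ} (hab : ∀ i, b i ≤ a i + 1)
    {c : ℕ} (hc : 1 ≤ c) (T : Finset ι) :
    negPow c * ∏ i ∈ T, negPow (a i)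
      - (negPow c - 1) * ∏ i ∈ T, (negPow (a i) - negPow (-b i)) ∈ nonnegSeries := by
  classical
  rcases T.eq_empty_or_nonempty with rfl | hT
  · simp
  obtain ⟨j, hj, hmax⟩ := T.exists_max_image b hT
  obtain ⟨U, hU, rfl⟩ : ∃ U, j ∉ U ∧ T = insert j U :=
    ⟨T.erase j, by simp, (Finset.insert_erase hj).symm⟩
  clear hT hj
  induction U using Finset.induction_on with
  | empty =>
    have : negPow c * ∏ i ∈ insert j ∅, negPow (a i)
        - (negPow c - 1) * ∏ i ∈ insert j ∅, (negPow (a i) - negPow (-b i))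
        = negPow (a j) + negPow (c - b j) - negPow (-b j) := by
      simp only [insert_empty_eq, Finset.prod_singleton, sub_eq_add_neg (c : ℤ), negPow_add]
      ring
    rw [this]
    exact negPow_add_negPow_sub_mem (hab j)
  | insert t U ht ih =>
    have hjt : j ≠ t := by
      rintro rfl
      simp at hU
    have hjU : j ∉ U := fun h => hU (Finset.mem_insert_of_mem h)
    have htj : t ∉ insert j U := by simp [hjt.symm, ht]
    have ih' := ih hjU fun i hi => hmax i (by
      rcases Finset.mem_insert.1 hi with rfl | hi <;> simp [*])
    have hbt : b t ≤ c + ∑ i ∈ insert j U, a i := by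
      have h1 := hmax t (by simp)
      have h2 := hab j
      rw [Finset.sum_insert hjU]
      omega
    have hE : negPow c * (∏ i ∈ insert j U, negPow (a i)) * negPow (-b t) ∈ nonnegSeries := by
      rw [← negPow_sum, ← negPow_add, ← negPow_add,
        show (c : ℤ) + ∑ i ∈ insert j U, (a i : ℤ) + -b t
          = ((c + ∑ i ∈ insert j U, a i - b t : ℕ) : ℤ) by push_cast [hbt]; ring]
      exact negPow_natCast_mem _
    rw [Finset.insert_comm, Finset.prod_insert htj, Finset.prod_insert htj]
    convert add_mem (mul_mem ih' (negPow_sub_negPow_neg_mem (hab t))) hE using 1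
    ring

/-- Distributing the power over the blocks turns each factor into (1 - X)^(-⌊n_i/2⌋) - (1 -
X)^(⌈n_i/2⌉), which is nonnegative since the two halves differ by at most one. -/
lemma idealSeries_nonneg :
    negPow (-(∑ i, (n i + 1) / 2 : ℕ)) * idealSeries n ∈ nonnegSeries := by
  have : negPow (-(∑ i, (n i + 1) / 2 : ℕ)) * idealSeries n
      = ∏ i, (negPow (n i / 2 : ℕ) - negPow (-((n i + 1) / 2 : ℕ))) := by
    rw [Nat.cast_sum, ← Finset.sum_neg_distrib, negPow_sum, idealSeries, ← Finset.prod_mul_distrib]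
    refine Finset.prod_congr rfl fun i _ => ?_
    rw [mul_sub, mul_one, ← negPow_add]
    congr 2
    omega
  rw [this]
  exact prod_mem fun i _ => negPow_sub_negPow_neg_mem (by omega)

/-- Block j keeps its full exponent and plays the role of c in `halves_prod_mem`; the other blocks
are halved. -/
lemma quotientSeries_nonneg (j : Fin r) (hj : 1 ≤ n j) :
    negPow (-(∑ i, (n i + 1) / 2 - (n j + 1) / 2 : ℕ)) * quotientSeries n ∈ nonnegSeries := by
  have hs : ∑ i, (n i + 1) / 2 - (n j + 1) / 2 = ∑ i ∈ Finset.univ.erase j, (n i + 1) / 2 := by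
    rw [← Finset.add_sum_erase _ _ (Finset.mem_univ j)]
    omega
  have h := halves_prod_mem (a := fun i => n i / 2) (b := fun i => (n i + 1) / 2)
    (fun i => by omega) hj (Finset.univ.erase j)
  convert h using 1
  have h1 : ∏ i ∈ Finset.univ.erase j, negPow (n i / 2 : ℕ)
      = negPow (-(∑ i ∈ Finset.univ.erase j, (n i + 1) / 2 : ℕ)) *
        ∏ i ∈ Finset.univ.erase j, negPow (n i) := by
    rw [Nat.cast_sum, ← Finset.sum_neg_distrib, negPow_sum, ← Finset.prod_mul_distrib]
    refine Finset.prod_congr rfl fun i _ => ?_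
    rw [← negPow_add]
    congr 1
    omega
  have h2 : ∏ i ∈ Finset.univ.erase j, (negPow (n i / 2 : ℕ) - negPow (-((n i + 1) / 2 : ℕ)))
      = negPow (-(∑ i ∈ Finset.univ.erase j, (n i + 1) / 2 : ℕ)) *
        ∏ i ∈ Finset.univ.erase j, (negPow (n i) - 1) := by
    rw [Nat.cast_sum, ← Finset.sum_neg_distrib, negPow_sum, ← Finset.prod_mul_distrib]
    refine Finset.prod_congr rfl fun i _ => ?_
    rw [mul_sub, mul_one, ← negPow_add]
    congr 2
    omega
  rw [hs, h1, h2, quotientSeries, ← Finset.mul_prod_erase _ _ (Finset.mem_univ j),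
    ← Finset.mul_prod_erase _ _ (Finset.mem_univ j)]
  ring

end series

lemma ceil_half (n : ℕ) : ⌈(n : ℚ) / 2⌉₊ = (n + 1) / 2 := by
  apply le_antisymm
  · rw [Nat.ceil_le, div_le_iff₀ two_pos]
    exact_mod_cast show n ≤ (n + 1) / 2 * 2 by omega
  · have h := Nat.le_ceil ((n : ℚ) / 2)
    rw [div_le_iff₀ two_pos] at h
    have : n ≤ ⌈(n : ℚ) / 2⌉₊ * 2 := by exact_mod_cast h
    omega

lemma floor_half (m : ℕ) : ⌊(m : ℚ) / 2⌋₊ = m / 2 := by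
  exact_mod_cast Nat.floor_div_eq_div (K := ℚ) m 2

/-! ### Hilbert functions of S, of ideals and of quotients -/

section monomials

variable {K : Type u} [Field K] {σ : Type}

lemma weight_one_eq (m : σ →₀ ℕ) : Finsupp.weight (fun _ : σ => (1 : ℤ)) m = (m.degree : ℤ) := by
  rw [Finsupp.weight_apply, Finsupp.degree_apply]
  simp [Finsupp.sum]

lemma mem_stdGrading {k : ℤ} {f : MvPolynomial σ K} :
    f ∈ stdGrading K σ k ↔ ∀ m ∈ f.support, (m.degree : ℤ) = k := by
  rw [mem_weightedHomogeneousSubmodule, IsWeightedHomogeneous]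
  simp only [weight_one_eq, mem_support_iff]

lemma stdGrading_natCast (k : ℕ) :
    stdGrading K σ k = restrictSupport K {m : σ →₀ ℕ | m.degree = k} := by
  ext f
  rw [mem_stdGrading, mem_restrictSupport_iff]
  simp [Set.subset_def]

lemma stdGrading_of_neg {k : ℤ} (hk : k < 0) : stdGrading K σ k = ⊥ := by
  rw [eq_bot_iff]
  intro f hf
  rw [Submodule.mem_bot, ← support_eq_empty, Finset.eq_empty_iff_forall_notMem]
  intro m hm
  have := mem_stdGrading.1 hf m hm
  omega

lemma finrank_restrictSupport (s : Finset (σ →₀ ℕ)) :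
    Module.finrank K (restrictSupport K (s : Set (σ →₀ ℕ))) = s.card := by
  rw [Module.finrank_eq_nat_card_basis (basisRestrictSupport K (s : Set (σ →₀ ℕ)))]
  simp

lemma finite_restrictSupport (s : Finset (σ →₀ ℕ)) :
    Module.Finite K (restrictSupport K (s : Set (σ →₀ ℕ))) :=
  Module.Finite.of_basis (basisRestrictSupport K (s : Set (σ →₀ ℕ)))

lemma finrank_idealGrading_eq (I : Ideal (MvPolynomial σ K)) (k : ℤ) :
    Module.finrank K (idealGrading I k) =
      Module.finrank K (I.restrictScalars K ⊓ stdGrading K σ k : Submodule K _) := by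
  have h : (idealGrading I k).map (I.subtype.restrictScalars K) =
      I.restrictScalars K ⊓ stdGrading K σ k := by
    rw [idealGrading, Submodule.map_comap_eq]
    congr 1
    ext
    simp
  rw [← h]
  exact (Submodule.equivMapOfInjective _ (fun _ _ h => Subtype.ext h) _).finrank_eq

lemma finrank_idealGrading_of_neg (I : Ideal (MvPolynomial σ K)) {k : ℤ} (hk : k < 0) :
    Module.finrank K (idealGrading I k) = 0 := by
  rw [finrank_idealGrading_eq, stdGrading_of_neg hk, inf_bot_eq, finrank_bot]

lemma finrank_quotientGrading_of_neg (I : Ideal (MvPolynomial σ K)) {k : ℤ}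
    (hk : k < 0) : Module.finrank K (quotientGrading I k) = 0 := by
  rw [quotientGrading, stdGrading_of_neg hk, Submodule.map_bot, finrank_bot]

variable [Fintype σ] [DecidableEq σ]

lemma coe_finsuppAntidiag (k : ℕ) :
    ((Finset.univ.finsuppAntidiag k : Finset (σ →₀ ℕ)) : Set (σ →₀ ℕ)) = {m | m.degree = k} := by
  ext m
  simp [Finset.mem_finsuppAntidiag, Finsupp.degree_eq_sum]

instance finite_stdGrading (k : ℤ) : Module.Finite K (stdGrading K σ k) := by
  rcases lt_or_ge k 0 with hk | hk
  · rw [stdGrading_of_neg hk]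
    infer_instance
  · lift k to ℕ using hk
    rw [stdGrading_natCast, ← coe_finsuppAntidiag]
    exact finite_restrictSupport _

lemma finrank_stdGrading (k : ℕ) :
    (Module.finrank K (stdGrading K σ k) : ℤ)
      = PowerSeries.coeff k (negPow (Fintype.card σ)) := by
  rw [stdGrading_natCast, ← coe_finsuppAntidiag, finrank_restrictSupport,
    Finset.card_finsuppAntidiag_nat_eq_multichoose, coeff_negPow, multichoose_natCast,
    Finset.card_univ]

lemma finrank_quotientGrading_add (I : Ideal (MvPolynomial σ K)) (k : ℤ) :
    Module.finrank K (quotientGrading I k) + Module.finrank K (idealGrading I k) =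
      Module.finrank K (stdGrading K σ k) := by
  let f := (Ideal.Quotient.mkₐ K I).toLinearMap
  have h := (f.domRestrict (stdGrading K σ k)).finrank_range_add_finrank_ker
  rw [LinearMap.range_domRestrict] at h
  rw [quotientGrading, ← h, finrank_idealGrading_eq]
  congr 1
  have h2 : (LinearMap.ker (f.domRestrict (stdGrading K σ k))).map (stdGrading K σ k).subtype =
      I.restrictScalars K ⊓ stdGrading K σ k := by
    ext x
    simp only [Submodule.mem_map, LinearMap.mem_ker, LinearMap.domRestrict_apply,
      Submodule.subtype_apply, Subtype.exists, Submodule.mem_inf, Submodule.restrictScalars_mem]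
    constructor
    · rintro ⟨a, ha, h1, rfl⟩
      exact ⟨Ideal.Quotient.eq_zero_iff_mem.1 h1, ha⟩
    · rintro ⟨h1, h2⟩
      exact ⟨x, h2, Ideal.Quotient.eq_zero_iff_mem.2 h1, rfl⟩
  rw [← h2]
  exact (Submodule.equivMapOfInjective _ (Submodule.subtype_injective _) _).finrank_eq.symm

end monomials

/-! ### The Hilbert series of the block ideal and its quotient -/

section block

variable {K : Type u} [Field K] {r : ℕ} (n : Fin r → ℕ)

lemma mem_blockIdeal {f : MvPolynomial (Σ i : Fin r, Fin (n i)) K} :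
    f ∈ blockIdeal K n ↔ ∀ m ∈ f.support, ∀ i, ∃ j, m ⟨i, j⟩ ≠ 0 := by
  rw [blockIdeal, Ideal.mem_iInf]
  have h : ∀ i, f ∈ Ideal.span (Set.range fun j : Fin (n i) => (X ⟨i, j⟩ :
      MvPolynomial (Σ i : Fin r, Fin (n i)) K)) ↔ ∀ m ∈ f.support, ∃ j, m ⟨i, j⟩ ≠ 0 := by
    intro i
    have : (Set.range fun j : Fin (n i) => (X ⟨i, j⟩ : MvPolynomial (Σ i : Fin r, Fin (n i)) K))
        = X '' Set.range fun j : Fin (n i) => (⟨i, j⟩ : Σ i : Fin r, Fin (n i)) := by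
      rw [← Set.range_comp]
      rfl
    rw [this, mem_ideal_span_X_image]
    simp
  simp only [h]
  exact ⟨fun H m hm i => H i m hm, fun H i m hm => H m hm i⟩

/-- Inclusion–exclusion over the set J of blocks that a monomial avoids; the monomials avoiding J
live in N - ∑_J n_i variables. -/
lemma card_touching (k : ℕ) :
    (((Finset.univ.finsuppAntidiag k : Finset ((Σ i : Fin r, Fin (n i)) →₀ ℕ)).filter
      fun m => ∀ i, ∃ j, m ⟨i, j⟩ ≠ 0).card : ℤ) = PowerSeries.coeff k (idealSeries n) := by
  classical
  have h1 : ∀ m : (Σ i : Fin r, Fin (n i)) →₀ ℕ,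
      (if ∀ i, ∃ j, m ⟨i, j⟩ ≠ 0 then (1 : ℤ) else 0) =
        ∑ J : Finset (Fin r), (-1) ^ J.card * if ∀ i ∈ J, ∀ j, m ⟨i, j⟩ = 0 then 1 else 0 := by
    intro m
    have h2 : ∀ J : Finset (Fin r), (-1) ^ J.card *
        (if ∀ i ∈ J, ∀ j, m ⟨i, j⟩ = 0 then (1 : ℤ) else 0) =
        (∏ i ∈ J, - if ∀ j, m ⟨i, j⟩ = 0 then (1 : ℤ) else 0) * ∏ i ∈ Finset.univ \ J, 1 := by
      intro J
      rw [Finset.prod_neg, Finset.prod_const_one, mul_one, Finset.prod_ite_zero]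
      simp
    simp only [h2]
    rw [← Finset.powerset_univ, ← Finset.prod_add]
    have h3 : ∀ i, (-(if ∀ j, m ⟨i, j⟩ = 0 then (1 : ℤ) else 0) + 1)
        = if ∃ j, m ⟨i, j⟩ ≠ 0 then 1 else 0 := by
      intro i
      by_cases h : ∀ j, m ⟨i, j⟩ = 0
      · simp [h]
      · rw [if_neg h, if_pos (not_forall.1 h)]
        simp
    simp only [h3]
    rw [Finset.prod_ite_zero]
    simp
  rw [Finset.card_filter]
  push_cast
  simp only [h1]
  rw [Finset.sum_comm, idealSeries_eq_sum, map_sum]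
  refine Finset.sum_congr rfl fun J _ => ?_
  rw [← Finset.mul_sum, coeff_neg_one_pow_mul, coeff_negPow, ← Finset.sum_filter]
  congr 1
  have h4 : (Finset.univ.finsuppAntidiag k : Finset ((Σ i : Fin r, Fin (n i)) →₀ ℕ)).filter
      (fun m => ∀ i ∈ J, ∀ j, m ⟨i, j⟩ = 0)
      = (Jᶜ.sigma fun i => (Finset.univ : Finset (Fin (n i)))).finsuppAntidiag k := by
    ext m
    simp only [Finset.mem_filter, Finset.mem_finsuppAntidiag', Finset.subset_univ, and_true,
      and_congr_right_iff]
    intro _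
    constructor
    · rintro h ⟨i, j⟩ hm
      simp only [Finset.mem_sigma, Finset.mem_compl, Finset.mem_univ, and_true]
      exact fun hi => (Finsupp.mem_support_iff.1 hm) (h i hi j)
    · intro h i hi j
      by_contra hne
      have := h (Finsupp.mem_support_iff.2 hne)
      simp [hi] at this
  have h5 : (∑ i, (n i : ℤ)) - ∑ i ∈ J, (n i : ℤ) = ((∑ i ∈ Jᶜ, n i : ℕ) : ℤ) := by
    rw [← Finset.sum_add_sum_compl J]
    push_cast
    ring
  rw [h4, Finset.sum_const, nsmul_eq_mul, mul_one,
    Finset.card_finsuppAntidiag_nat_eq_multichoose, h5, multichoose_natCast]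
  simp [Finset.card_sigma]

lemma finrank_idealGrading_blockIdeal (k : ℕ) :
    (Module.finrank K (idealGrading (blockIdeal K n) k) : ℤ)
      = PowerSeries.coeff k (idealSeries n) := by
  classical
  rw [finrank_idealGrading_eq, ← card_touching, ← finrank_restrictSupport (K := K)]
  refine congrArg (fun V : Submodule K (MvPolynomial (Σ i : Fin r, Fin (n i)) K) =>
    (Module.finrank K V : ℤ)) ?_
  ext f
  rw [Submodule.mem_inf, Submodule.restrictScalars_mem, mem_blockIdeal, mem_stdGrading,
    mem_restrictSupport_iff, Finset.coe_filter]
  have h : ∀ m : (Σ i : Fin r, Fin (n i)) →₀ ℕ, m ∈ Finset.univ.finsuppAntidiag k ↔ m.degree = k :=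
    fun m => by rw [← Finset.mem_coe, coe_finsuppAntidiag]; rfl
  simp only [h, Set.subset_def, Finset.mem_coe, Set.mem_ofPred_eq, Nat.cast_inj]
  exact ⟨fun H m hm => ⟨H.2 m hm, H.1 m hm⟩, fun H => ⟨fun m hm => (H m hm).2, fun m hm => (H m hm).1⟩⟩

lemma finrank_quotientGrading_blockIdeal (k : ℕ) :
    (Module.finrank K (quotientGrading (blockIdeal K n) k) : ℤ)
      = PowerSeries.coeff k (quotientSeries n) := by
  have h := finrank_quotientGrading_add (blockIdeal K n) (k : ℤ)
  zify at h
  rw [finrank_idealGrading_blockIdeal, finrank_stdGrading] at h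
  rw [eq_sub_of_add_eq h, quotientSeries, ← idealSeries, map_sub, ← negPow_sum]
  simp

end block

/-! ### Exchange of regular elements -/

section exchange

open RingTheory.Sequence Pointwise

variable {R : Type*} [CommRing R] (I : Ideal R)

/-- There is a weakly `M`-regular sequence of length `d` with entries in `I`. -/
def HasWeaklyRegular (M : Type*) [AddCommGroup M] [Module R M] (d : ℕ) : Prop :=
  ∃ rs : List R, (∀ x ∈ rs, x ∈ I) ∧ IsWeaklyRegular M rs ∧ rs.length = d

variable {I}

lemma hasWeaklyRegular_succ {M : Type*} [AddCommGroup M] [Module R M] {d : ℕ} :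
    HasWeaklyRegular I M (d + 1) ↔
      ∃ x ∈ I, IsSMulRegular M x ∧ HasWeaklyRegular I (QuotSMulTop x M) d := by
  constructor
  · rintro ⟨rs, hI, hreg, hlen⟩
    match rs with
    | x :: rs =>
      rw [isWeaklyRegular_cons_iff] at hreg
      exact ⟨x, hI x (by simp), hreg.1, rs, fun y hy => hI y (by simp [hy]), hreg.2, by simpa using hlen⟩
  · rintro ⟨x, hx, hreg, rs, hI, hrs, hlen⟩
    refine ⟨x :: rs, ?_, (isWeaklyRegular_cons_iff M x rs).2 ⟨hreg, hrs⟩, by simp [hlen]⟩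
    simpa [hx] using hI

lemma HasWeaklyRegular.congr {M M' : Type*} [AddCommGroup M] [Module R M] [AddCommGroup M']
    [Module R M'] (e : M ≃ₗ[R] M') {d : ℕ} (h : HasWeaklyRegular I M d) :
    HasWeaklyRegular I M' d := by
  obtain ⟨rs, hI, hreg, hlen⟩ := h
  exact ⟨rs, hI, (e.isWeaklyRegular_congr rs).1 hreg, hlen⟩

variable {M : Type*} [AddCommGroup M] [Module R M]

lemma mem_smul_top_iff {x : R} {m : M} : m ∈ x • (⊤ : Submodule R M) ↔ ∃ m', x • m' = m := by
  rw [Submodule.mem_smul_pointwise_iff_exists]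
  simp

lemma isSMulRegular_quotSMulTop_iff {x z : R} :
    IsSMulRegular (QuotSMulTop x M) z ↔ ∀ m m' : M, z • m = x • m' → ∃ c, m = x • c := by
  rw [isSMulRegular_quotient_iff_mem_of_smul_mem]
  simp only [mem_smul_top_iff]
  constructor
  · intro h m m' hm
    obtain ⟨c, hc⟩ := h m ⟨m', hm.symm⟩
    exact ⟨c, hc.symm⟩
  · rintro h m ⟨m', hm⟩
    obtain ⟨c, hc⟩ := h m m' hm.symm
    exact ⟨c, hc.symm⟩

lemma IsSMulRegular.quotSMulTop_swap {x z : R} (hx : IsSMulRegular M x)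
    (hz : IsSMulRegular (QuotSMulTop x M) z) : IsSMulRegular (QuotSMulTop z M) x := by
  rw [isSMulRegular_quotSMulTop_iff] at hz ⊢
  intro m b h
  obtain ⟨c, rfl⟩ := hz b m h.symm
  exact ⟨c, hx (by simpa [smul_comm z x c] using h)⟩

/-- Dividing by `x` and by `z` in either order gives the same module. -/
noncomputable def quotSMulTopSwap (x z : R) (M : Type*) [AddCommGroup M] [Module R M] :
    QuotSMulTop x (QuotSMulTop z M) ≃ₗ[R] QuotSMulTop z (QuotSMulTop x M) :=
  have h : ∀ a b : R, a • (⊤ : Submodule R (QuotSMulTop b M)) =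
      (a • (⊤ : Submodule R M)).map (b • (⊤ : Submodule R M)).mkQ := fun a b => by
    rw [Submodule.map_pointwise_smul, Submodule.map_top, Submodule.range_mkQ]
  Submodule.quotEquivOfEq _ _ (h x z) ≪≫ₗ
    Submodule.quotientQuotientEquivQuotientSup _ _ ≪≫ₗ
    Submodule.quotEquivOfEq _ _ (sup_comm _ _) ≪≫ₗ
    (Submodule.quotientQuotientEquivQuotientSup _ _).symm ≪≫ₗ
    Submodule.quotEquivOfEq _ _ (h z x).symm

lemma not_le_associatedPrime [IsNoetherianRing R] (h : ∀ w : M, (∀ a ∈ I, a • w = 0) → w = 0)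
    {p : Ideal R} (hp : p ∈ associatedPrimes R M) : ¬ I ≤ p := by
  intro hle
  obtain ⟨hprime, w, rfl⟩ := isAssociatedPrime_iff.1 hp
  have hw : w = 0 := h w fun a ha => by simpa using hle ha
  exact hprime.ne_top (by simp [hw])

lemma exists_mem_associatedPrimes [IsNoetherianRing R] {z : R} (hz : ¬ IsSMulRegular M z) :
    ∃ p ∈ associatedPrimes R M, z ∈ p := by
  have : z ∈ {r : R | IsSMulRegular M r}ᶜ := hz
  rw [← biUnion_associatedPrimes_eq_compl_regular] at this
  simpa using this

lemma eq_zero_of_isSMulRegular {x : R} (hx : x ∈ I) (hreg : IsSMulRegular M x) (w : M)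
    (hw : ∀ a ∈ I, a • w = 0) : w = 0 :=
  hreg.right_eq_zero_of_smul (hw x hx)

/-- Prime avoidance: if I contained no common regular element, it would lie in a single associated
prime of one of the modules, hence annihilate a nonzero element. -/
lemma exists_isSMulRegular_three [IsNoetherianRing R] {M₁ M₂ M₃ : Type*}
    [AddCommGroup M₁] [Module R M₁] [Module.Finite R M₁]
    [AddCommGroup M₂] [Module R M₂] [Module.Finite R M₂]
    [AddCommGroup M₃] [Module R M₃] [Module.Finite R M₃]
    (h₁ : ∀ w : M₁, (∀ a ∈ I, a • w = 0) → w = 0)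
    (h₂ : ∀ w : M₂, (∀ a ∈ I, a • w = 0) → w = 0)
    (h₃ : ∀ w : M₃, (∀ a ∈ I, a • w = 0) → w = 0) :
    ∃ z ∈ I, IsSMulRegular M₁ z ∧ IsSMulRegular M₂ z ∧ IsSMulRegular M₃ z := by
  by_contra! hcon
  have hfin : (associatedPrimes R M₁ ∪ associatedPrimes R M₂ ∪ associatedPrimes R M₃).Finite :=
    ((associatedPrimes.finite R M₁).union (associatedPrimes.finite R M₂)).union
      (associatedPrimes.finite R M₃)
  have hsub : (I : Set R) ⊆
      ⋃ p ∈ associatedPrimes R M₁ ∪ associatedPrimes R M₂ ∪ associatedPrimes R M₃,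
        ((p : Ideal R) : Set R) := by
    intro z hz
    simp only [Set.mem_iUnion, exists_prop, Set.mem_union]
    by_cases z₁ : IsSMulRegular M₁ z
    · by_cases z₂ : IsSMulRegular M₂ z
      · obtain ⟨p, hp, hzp⟩ := exists_mem_associatedPrimes (hcon z hz z₁ z₂)
        exact ⟨p, Or.inr hp, hzp⟩
      · obtain ⟨p, hp, hzp⟩ := exists_mem_associatedPrimes z₂
        exact ⟨p, Or.inl (Or.inr hp), hzp⟩
    · obtain ⟨p, hp, hzp⟩ := exists_mem_associatedPrimes z₁
      exact ⟨p, Or.inl (Or.inl hp), hzp⟩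
  obtain ⟨p, hp, hle⟩ := (Ideal.subset_union_prime_finite hfin (f := id) ⊤ ⊤
    (fun p hp _ _ => by rcases hp with (hp | hp) | hp <;> exact hp.isPrime)).1 hsub
  rcases hp with (hp | hp) | hp
  · exact not_le_associatedPrime h₁ hp hle
  · exact not_le_associatedPrime h₂ hp hle
  · exact not_le_associatedPrime h₃ hp hle

/-- The length of the weakly regular sequences in `I` drops by exactly one when dividing by any
regular element of `I`. -/
theorem HasWeaklyRegular.quotSMulTop [IsNoetherianRing R] [Module.Finite R M] {y : R} (hy : y ∈ I) (hreg : IsSMulRegular M y) {d : ℕ}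
    (h : HasWeaklyRegular I M (d + 1)) : HasWeaklyRegular I (QuotSMulTop y M) d := by
  induction d generalizing M y with
  | zero => exact ⟨[], by simp, by simp, rfl⟩
  | succ d ih =>
    obtain ⟨x, hx, hxM, hd⟩ := hasWeaklyRegular_succ.1 h
    obtain ⟨x', hx', hxM', -⟩ := hasWeaklyRegular_succ.1 hd
    -- If I kills z modulo y, then xz = yw and x'z = yz'. Cancelling y gives x'w = xz', so w = xc
    -- because x' is regular modulo x, and cancelling x in xz = yxc gives z = yc.
    have hy0 : ∀ w : QuotSMulTop y M, (∀ a ∈ I, a • w = 0) → w = 0 := by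
      intro w hw
      obtain ⟨z, rfl⟩ := Submodule.Quotient.mk_surjective _ w
      have hw' : ∀ a ∈ I, ∃ m, y • m = a • z := fun a ha => by
        have := hw a ha
        rwa [← Submodule.Quotient.mk_smul, Submodule.Quotient.mk_eq_zero, mem_smul_top_iff] at this
      obtain ⟨w, hw⟩ := hw' x hx
      obtain ⟨z', hz'⟩ := hw' x' hx'
      obtain ⟨c, rfl⟩ := isSMulRegular_quotSMulTop_iff.1 hxM' w z' (hreg (by
        simp only
        rw [smul_comm y x' w, hw, smul_comm y x z', hz', smul_comm]))
      rw [Submodule.Quotient.mk_eq_zero, mem_smul_top_iff]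
      exact ⟨c, hxM (by simp only; rw [← hw, smul_comm])⟩
    -- The element z links x to y: the induction hypothesis is applied to M/xM with z, then to M/zM
    -- with y, and the order of division is swapped each time.
    obtain ⟨z, hz, hzM, hzx, hzy⟩ := exists_isSMulRegular_three
      (eq_zero_of_isSMulRegular hy hreg) (eq_zero_of_isSMulRegular hx' hxM') hy0
    have h1 : HasWeaklyRegular I (QuotSMulTop z M) (d + 1) :=
      hasWeaklyRegular_succ.2 ⟨x, hx, IsSMulRegular.quotSMulTop_swap hxM hzx,
        (ih hz hzx hd).congr (quotSMulTopSwap z x M)⟩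
    have h2 := ih hy (IsSMulRegular.quotSMulTop_swap hreg hzy) h1
    exact hasWeaklyRegular_succ.2 ⟨z, hz, hzy, h2.congr (quotSMulTopSwap y z M)⟩

end exchange

open Pointwise

/-! ### Linear forms and differences of Hilbert functions -/

/-- The difference operator `f ↦ (k ↦ f k - f (k - 1))`. -/
def diff (f : ℤ → ℤ) (k : ℤ) : ℤ := f k - f (k - 1)

/-- The projections `p k` of `M` on its homogeneous components: idempotent, compatible with the
multiplication by variables, with finite-dimensional images. -/
structure IsProjectionFamily (K : Type*) [Field K] {σ : Type} {M : Type*} [AddCommGroup M]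
    [Module K M] [Module (MvPolynomial σ K) M] (p : ℤ → M →ₗ[K] M) : Prop where
  idem : ∀ k m, p k (p k m) = p k m
  X_smul : ∀ v k m, p (k + 1) ((X v : MvPolynomial σ K) • m) = (X v : MvPolynomial σ K) • p k m
  finite : ∀ k, FiniteDimensional K (LinearMap.range (p k))

/-- The Hilbert function attached to a family of projections. -/
noncomputable def hilbertFun {K : Type*} [Field K] {M : Type*} [AddCommGroup M]
    [Module K M] (p : ℤ → M →ₗ[K] M) (k : ℤ) : ℤ := Module.finrank K (LinearMap.range (p k))

section infinite

variable {K : Type*} [Field K] {σ : Type} {M : Type*} [AddCommGroup M]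
    [Module K M] [Module (MvPolynomial σ K) M] [IsScalarTower K (MvPolynomial σ K) M]

/-- The linear form with given coefficients. -/
noncomputable def linearForm [Fintype σ] : (σ → K) →ₗ[K] MvPolynomial σ K :=
  Fintype.linearCombination K X

lemma linearForm_apply [Fintype σ] (c : σ → K) :
    linearForm c = ∑ v, c v • (X v : MvPolynomial σ K) := by
  simp [linearForm, Fintype.linearCombination_apply]

lemma linearForm_mem [Fintype σ] (c : σ → K) :
    linearForm c ∈ Ideal.span (Set.range (X : σ → MvPolynomial σ K)) := by
  rw [linearForm_apply]
  refine sum_mem fun v _ => ?_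
  rw [MvPolynomial.smul_eq_C_mul]
  exact Ideal.mul_mem_left _ _ (Ideal.subset_span ⟨v, rfl⟩)

/-- The coefficient vectors of linear forms in a given associated prime form a proper subspace, and
finitely many proper subspaces do not cover a vector space over an infinite field. -/
lemma exists_linearForm_isSMulRegular [Infinite K] [Fintype σ] {N : Type*} [AddCommGroup N]
    [Module (MvPolynomial σ K) N] [Module.Finite (MvPolynomial σ K) N]
    (h : ∀ w : N, (∀ a ∈ Ideal.span (Set.range (X : σ → MvPolynomial σ K)), a • w = 0) → w = 0) :
    ∃ c : σ → K, IsSMulRegular N (linearForm c) := by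
  classical
  by_contra! hcon
  have hfin := associatedPrimes.finite (MvPolynomial σ K) N
  let s : Finset (Subspace K (σ → K)) :=
    hfin.toFinset.image fun p => (p.restrictScalars K).comap linearForm
  have hs : ⊤ ∉ s := by
    intro htop
    obtain ⟨p, hp, hpt⟩ := Finset.mem_image.1 htop
    refine not_le_associatedPrime h (hfin.mem_toFinset.1 hp) ?_
    rw [Ideal.span_le]
    rintro _ ⟨v, rfl⟩
    have : Pi.single v (1 : K) ∈ (p.restrictScalars K).comap linearForm := by
      rw [hpt]
      trivial
    rw [Submodule.mem_comap, linearForm_apply] at this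
    simpa [Pi.single_apply] using this
  refine Subspace.biUnion_ne_univ_of_top_notMem hs (Set.eq_univ_of_forall fun c => ?_)
  obtain ⟨p, hp, hc⟩ := exists_mem_associatedPrimes (hcon c)
  simp only [Set.mem_iUnion, exists_prop]
  exact ⟨_, Finset.mem_image_of_mem _ (hfin.mem_toFinset.2 hp), hc⟩

lemma IsProjectionFamily.linearForm_smul [Fintype σ] {p : ℤ → M →ₗ[K] M}
    (hp : IsProjectionFamily (σ := σ) K p) (c : σ → K) (k : ℤ) (m : M) :
    p (k + 1) (linearForm c • m) = linearForm c • p k m := by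
  simp only [linearForm_apply, Finset.sum_smul, map_sum, smul_assoc, map_smul, hp.X_smul]

/-- In degree k, multiplication by the form embeds the component of degree k - 1, and the component
of the quotient is the cokernel. -/
lemma IsProjectionFamily.exists_quotSMulTop [Fintype σ] {p : ℤ → M →ₗ[K] M}
    (hp : IsProjectionFamily (σ := σ) K p) {c : σ → K} (hc : IsSMulRegular M (linearForm c)) :
    ∃ q : ℤ → QuotSMulTop (linearForm c) M →ₗ[K] QuotSMulTop (linearForm c) M,
      IsProjectionFamily (σ := σ) K q ∧ hilbertFun q = diff (hilbertFun p) := by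
  set y := linearForm c with hy
  let P : Submodule (MvPolynomial σ K) M := y • ⊤
  let e : (M ⧸ P.restrictScalars K) ≃ₗ[K] M ⧸ P := Submodule.Quotient.restrictScalarsEquiv K P
  have hle : ∀ k, P.restrictScalars K ≤ (P.restrictScalars K).comap (p k) := by
    intro k m hm
    obtain ⟨m', rfl⟩ := mem_smul_top_iff.1 hm
    refine mem_smul_top_iff.2 ⟨p (k - 1) m', ?_⟩
    rw [← hp.linearForm_smul, sub_add_cancel]
  let q : ℤ → QuotSMulTop y M →ₗ[K] QuotSMulTop y M := fun k =>
    e.toLinearMap ∘ₗ (P.restrictScalars K).mapQ (P.restrictScalars K) (p k) (hle k) ∘ₗ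
      e.symm.toLinearMap
  have hq : ∀ k m, q k (Submodule.Quotient.mk m) = Submodule.Quotient.mk (p k m) := fun k m => rfl
  let mk : M →ₗ[K] QuotSMulTop y M := P.mkQ.restrictScalars K
  have hrange : ∀ k, LinearMap.range (q k) = (LinearMap.range (p k)).map mk := by
    intro k
    ext z
    simp only [LinearMap.mem_range, Submodule.mem_map, exists_exists_eq_and]
    constructor
    · rintro ⟨w, rfl⟩
      obtain ⟨m, rfl⟩ := Submodule.Quotient.mk_surjective _ w
      exact ⟨m, (hq k m).symm⟩
    · rintro ⟨m, rfl⟩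
      exact ⟨Submodule.Quotient.mk m, hq k m⟩
  refine ⟨q, ⟨?_, ?_, ?_⟩, ?_⟩
  · intro k w
    obtain ⟨m, rfl⟩ := Submodule.Quotient.mk_surjective _ w
    rw [hq, hq, hp.idem]
  · intro v k w
    obtain ⟨m, rfl⟩ := Submodule.Quotient.mk_surjective _ w
    rw [hq, ← Submodule.Quotient.mk_smul, hq, ← Submodule.Quotient.mk_smul, hp.X_smul]
  · intro k
    have := hp.finite k
    rw [hrange]
    infer_instance
  · funext k
    have := hp.finite k
    let A := LinearMap.range (p k)
    have h := (mk.domRestrict A).finrank_range_add_finrank_ker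
    rw [LinearMap.range_domRestrict, ← hrange] at h
    let f : M →ₗ[K] M := (LinearMap.lsmul (MvPolynomial σ K) M y).restrictScalars K
    have hf : ∀ m, f m = y • m := fun m => rfl
    have hker : (LinearMap.ker (mk.domRestrict A)).map A.subtype =
        (LinearMap.range (p (k - 1))).map f := by
      ext x
      simp only [Submodule.mem_map, LinearMap.mem_ker, LinearMap.domRestrict_apply,
        Submodule.subtype_apply, Subtype.exists, LinearMap.mem_range, exists_exists_eq_and, hf]
      constructor
      · rintro ⟨_, ⟨m, rfl⟩, h1, rfl⟩
        obtain ⟨m', hm'⟩ := mem_smul_top_iff.1 ((Submodule.Quotient.mk_eq_zero _).1 h1)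
        refine ⟨m', ?_⟩
        rw [← hp.linearForm_smul, sub_add_cancel, ← hy, hm', hp.idem]
      · rintro ⟨m, rfl⟩
        refine ⟨y • p (k - 1) m, ⟨y • m, ?_⟩, ?_, rfl⟩
        · rw [← hp.linearForm_smul, sub_add_cancel]
        · exact (Submodule.Quotient.mk_eq_zero _).2 (mem_smul_top_iff.2 ⟨_, rfl⟩)
    have h2 : Module.finrank K (LinearMap.ker (mk.domRestrict A)) =
        Module.finrank K (LinearMap.range (p (k - 1))) := by
      rw [(Submodule.equivMapOfInjective A.subtype A.injective_subtype _).finrank_eq, hker]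
      exact (Submodule.equivMapOfInjective f hc _).finrank_eq.symm
    rw [h2] at h
    rw [hilbertFun, diff, hilbertFun, hilbertFun, eq_sub_iff_add_eq]
    exact_mod_cast h

/-- Over an infinite field, the existence of a weakly regular sequence of length `d` forces the
`d`-th difference of the Hilbert function to be nonnegative. -/
theorem IsProjectionFamily.diff_iterate_nonneg_of_infinite [Infinite K] [Fintype σ] {M : Type u}
    [AddCommGroup M] [Module K M] [Module (MvPolynomial σ K) M]
    [IsScalarTower K (MvPolynomial σ K) M]
    [Module.Finite (MvPolynomial σ K) M] {p : ℤ → M →ₗ[K] M}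
    (hp : IsProjectionFamily (σ := σ) K p) {d : ℕ}
    (hd : HasWeaklyRegular (Ideal.span (Set.range (X : σ → MvPolynomial σ K))) M d) (k : ℤ) :
    0 ≤ diff^[d] (hilbertFun p) k := by
  induction d generalizing M with
  | zero => exact Int.natCast_nonneg _
  | succ d ih =>
    obtain ⟨x, hx, hreg, -⟩ := hasWeaklyRegular_succ.1 hd
    obtain ⟨c, hc⟩ := exists_linearForm_isSMulRegular (K := K) (eq_zero_of_isSMulRegular hx hreg)
    obtain ⟨q, hq, hqp⟩ := hp.exists_quotSMulTop hc
    rw [Function.iterate_succ_apply, ← hqp]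
    exact ih hq (hd.quotSMulTop (linearForm_mem c) hc)

end infinite

/-! ### Reduction to an infinite field -/

section baseChange

attribute [local instance] MvPolynomial.algebraMvPolynomial

open TensorProduct

/-- The base change of the image of a linear map is the image of its base change. -/
noncomputable def baseChangeRangeEquiv {K : Type*} (L : Type*) [Field K] [Field L] [Algebra K L]
    {M : Type*} [AddCommGroup M] [Module K M] (f : M →ₗ[K] M) :
    L ⊗[K] LinearMap.range f ≃ₗ[L] LinearMap.range (f.baseChange L) :=
  have hinj : Function.Injective ((LinearMap.range f).subtype.baseChange L) :=
    Module.Flat.lTensor_preserves_injective_linearMap _ (Submodule.injective_subtype _)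
  have hrange : LinearMap.range ((LinearMap.range f).subtype.baseChange L) =
      LinearMap.range (f.baseChange L) := by
    have h : f.baseChange L =
        (LinearMap.range f).subtype.baseChange L ∘ₗ f.rangeRestrict.baseChange L := by
      rw [← LinearMap.baseChange_comp]
      rfl
    rw [h, LinearMap.range_comp_of_range_eq_top]
    exact LinearMap.range_eq_top.2 (LinearMap.lTensor_surjective L f.surjective_rangeRestrict)
  LinearEquiv.ofInjective _ hinj ≪≫ₗ LinearEquiv.ofEq _ _ hrange

/-- The existence of a weakly regular sequence of length `d` forces the `d`-th difference of the
Hilbert function to be nonnegative. -/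
theorem IsProjectionFamily.diff_iterate_nonneg {K : Type*} [Field K] {σ : Type} [Fintype σ]
    {M : Type*} [AddCommGroup M] [Module K M] [Module (MvPolynomial σ K) M]
    [IsScalarTower K (MvPolynomial σ K) M]
    [Module.Finite (MvPolynomial σ K) M] {p : ℤ → M →ₗ[K] M}
    (hp : IsProjectionFamily (σ := σ) K p) {d : ℕ}
    (hd : HasWeaklyRegular (Ideal.span (Set.range (X : σ → MvPolynomial σ K))) M d) (k : ℤ) :
    0 ≤ diff^[d] (hilbertFun p) k := by
  let L := AlgebraicClosure K
  have : Infinite L := IsAlgClosed.instInfinite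
  let S := MvPolynomial σ K
  let S' := MvPolynomial σ L
  -- The left side carries the S'-module structure and the regular sequence, the right side the
  -- projections and their ranks.
  let e : S' ⊗[S] M ≃ₗ[L] L ⊗[K] M := Algebra.IsPushout.cancelBaseChange K L S S' M
  have he : ∀ (l : L) (m : M), e.symm (l ⊗ₜ m) = (C l : S') ⊗ₜ[S] m := fun l m =>
    Algebra.IsPushout.cancelBaseChange_symm_tmul K L S S' M l m
  let q : ℤ → S' ⊗[S] M →ₗ[L] S' ⊗[S] M := fun k =>
    e.symm.toLinearMap ∘ₗ (p k).baseChange L ∘ₗ e.toLinearMap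
  have hq : ∀ k z, q k (e.symm z) = e.symm ((p k).baseChange L z) := fun k z => by simp [q]
  have hrange : ∀ k, Nonempty (L ⊗[K] LinearMap.range (p k) ≃ₗ[L] LinearMap.range (q k)) := by
    intro k
    have h : LinearMap.range (q k) =
        (LinearMap.range ((p k).baseChange L)).map e.symm.toLinearMap := by
      rw [LinearMap.range_comp, LinearEquiv.range_comp]
    rw [h]
    exact ⟨(baseChangeRangeEquiv L (p k)).trans (e.symm.submoduleMap _)⟩
  have hfr : hilbertFun q = hilbertFun p := by
    funext k
    rw [hilbertFun, hilbertFun, ← (hrange k).some.finrank_eq, Module.finrank_baseChange]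
  have hqp : IsProjectionFamily (σ := σ) L q := by
    refine ⟨fun k z => ?_, fun v k z => ?_, fun k => ?_⟩
    · obtain ⟨z, rfl⟩ := e.symm.surjective z
      rw [hq, hq]
      congr 1
      rw [← LinearMap.comp_apply, ← LinearMap.baseChange_comp]
      congr 2
      ext m
      exact hp.idem k m
    · obtain ⟨z, rfl⟩ := e.symm.surjective z
      induction z using TensorProduct.induction_on with
      | zero => simp
      | add a b ha hb => simp only [map_add, smul_add, ha, hb]
      | tmul l m =>
        have hX : ∀ m : M, (X v : S') • ((C l : S') ⊗ₜ[S] m) = (C l : S') ⊗ₜ[S] ((X v : S) • m) := by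
          intro m
          rw [TensorProduct.smul_tmul', TensorProduct.tmul_smul, TensorProduct.smul_tmul']
          congr 1
          rw [smul_eq_mul, Algebra.smul_def, MvPolynomial.algebraMap_def, map_X]
        rw [he, hX, ← he, hq, ← he, hq]
        simp only [LinearMap.baseChange_tmul, he, hX, hp.X_smul]
    · have := hp.finite k
      exact Module.Finite.equiv (hrange k).some
  have hwr : HasWeaklyRegular (Ideal.span (Set.range (X : σ → S'))) (S' ⊗[S] M) d := by
    obtain ⟨rs, hI, hreg, hlen⟩ := hd
    have : Module.Flat S S' :=
      Module.Flat.isBaseChange K S L S' (Algebra.IsPushout.out (R := K) (S := S) (R' := L) (S' := S'))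
    refine ⟨rs.map (algebraMap S S'), ?_,
      hreg.of_flat_of_isBaseChange (TensorProduct.isBaseChange S M S'), by simp [hlen]⟩
    intro x hx
    obtain ⟨f, hf, rfl⟩ := List.mem_map.1 hx
    have := Ideal.mem_map_of_mem (algebraMap S S') (hI f hf)
    rw [Ideal.map_span, ← Set.range_comp] at this
    have hX : algebraMap S S' ∘ X = (X : σ → S') := by
      funext v
      simp [S, S']
    rw [hX] at this
    exact this
  rw [← hfr]
  exact hqp.diff_iterate_nonneg_of_infinite hwr k

end baseChange

section series

/-- Vanishing in negative degrees is needed because the difference at 0 involves g(-1), which the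
series does not see. -/
lemma mk_diff_iterate (d : ℕ) (g : ℤ → ℤ) (hg : ∀ k < 0, g k = 0) :
    PowerSeries.mk (fun k : ℕ => diff^[d] g k) =
      negPow (-d) * PowerSeries.mk (fun k : ℕ => g k) := by
  rw [negPow_neg_natCast]
  induction d generalizing g with
  | zero => simp
  | succ d ih =>
    have h : PowerSeries.mk (fun k : ℕ => diff g k) =
        (1 - PowerSeries.X) * PowerSeries.mk (fun k : ℕ => g k) := by
      ext k
      rw [sub_mul, one_mul, map_sub, PowerSeries.coeff_mk, PowerSeries.coeff_mk, diff]
      cases k with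
      | zero => simp [hg (-1) (by norm_num)]
      | succ k => rw [PowerSeries.coeff_succ_X_mul, PowerSeries.coeff_mk]; simp
    simp only [Function.iterate_succ_apply]
    rw [ih (diff g) (fun k hk => by rw [diff, hg k hk, hg (k - 1) (by omega), sub_zero]), h, pow_succ,
      mul_assoc]

end series

/-! ### Projections and finiteness for graded modules -/

section grading

variable {K : Type u} [Field K] {σ : Type} {M : Type u} [AddCommGroup M] [Module K M]
  [Module (MvPolynomial σ K) M] {ℳ : ℤ → Submodule K M}

/-- The projections of a graded module on its homogeneous components. -/
noncomputable def IsGrading.proj (h : IsGrading (σ := σ) ℳ) (k : ℤ) : M →ₗ[K] M :=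
  letI := h.isInternal.chooseDecomposition
  (ℳ k).subtype ∘ₗ DirectSum.component K ℤ (fun k => ℳ k) k ∘ₗ
    (DirectSum.decomposeLinearEquiv ℳ).toLinearMap

variable (h : IsGrading (σ := σ) ℳ)

lemma IsGrading.proj_mem (k : ℤ) (m : M) : h.proj k m ∈ ℳ k := Subtype.property _

lemma IsGrading.proj_of_mem {k : ℤ} {m : M} (hm : m ∈ ℳ k) : h.proj k m = m :=
  letI := h.isInternal.chooseDecomposition
  DirectSum.decompose_of_mem_same ℳ hm

lemma IsGrading.proj_of_mem_ne {j k : ℤ} {m : M} (hm : m ∈ ℳ j) (hjk : j ≠ k) : h.proj k m = 0 :=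
  letI := h.isInternal.chooseDecomposition
  DirectSum.decompose_of_mem_ne ℳ hm hjk

include h in
lemma IsGrading.induction {P : M → Prop} (h0 : P 0) (hom : ∀ j, ∀ m ∈ ℳ j, P m)
    (add : ∀ m m', P m → P m' → P (m + m')) (m : M) : P m :=
  letI := h.isInternal.chooseDecomposition
  DirectSum.Decomposition.inductionOn ℳ h0 (fun {j} x => hom j x x.2) add m

lemma IsGrading.proj_smul {i : ℤ} {f : MvPolynomial σ K} (hf : f ∈ stdGrading K σ i) (k : ℤ)
    (m : M) : h.proj (i + k) (f • m) = f • h.proj k m := by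
  induction m using h.induction with
  | h0 => simp
  | hom j m hm =>
    by_cases hjk : j = k
    · subst hjk
      rw [h.proj_of_mem (h.smul_mem _ _ _ _ hf hm), h.proj_of_mem hm]
    · rw [h.proj_of_mem_ne (h.smul_mem _ _ _ _ hf hm) (by omega), h.proj_of_mem_ne hm hjk, smul_zero]
  | add m m' hm hm' => rw [smul_add, map_add, map_add, smul_add, hm, hm']

lemma IsGrading.range_proj (k : ℤ) : LinearMap.range (h.proj k) = ℳ k := by
  apply le_antisymm
  · rintro _ ⟨m, rfl⟩
    exact h.proj_mem k m
  · intro m hm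
    exact ⟨m, h.proj_of_mem hm⟩

include h in
lemma IsGrading.exists_eq_sum (m : M) : ∃ J : Finset ℤ, ∀ J', J ⊆ J' → m = ∑ j ∈ J', h.proj j m := by
  classical
  induction m using h.induction with
  | h0 => exact ⟨∅, by simp⟩
  | hom j m hm =>
    refine ⟨{j}, fun J' hJ' => ?_⟩
    rw [Finset.sum_eq_single_of_mem j (hJ' (by simp)), h.proj_of_mem hm]
    exact fun i _ hi => h.proj_of_mem_ne hm hi.symm
  | add m m' hm hm' =>
    obtain ⟨J, hJ⟩ := hm
    obtain ⟨I, hI⟩ := hm'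
    refine ⟨J ∪ I, fun J' hJ' => ?_⟩
    conv_lhs => rw [hJ J' (Finset.union_subset_left hJ'), hI J' (Finset.union_subset_right hJ')]
    simp [Finset.sum_add_distrib]

variable [IsScalarTower K (MvPolynomial σ K) M]

/-- The map `f ↦ f • m`. -/
noncomputable def smulMap (K : Type u) [Field K] (σ : Type) {M : Type u} [AddCommGroup M]
    [Module K M] [Module (MvPolynomial σ K) M] [IsScalarTower K (MvPolynomial σ K) M] (m : M) :
    MvPolynomial σ K →ₗ[K] M :=
  (LinearMap.toSpanSingleton (MvPolynomial σ K) M m).restrictScalars K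

lemma IsGrading.proj_smul_mem {j k : ℤ} {m : M} (hm : m ∈ ℳ j) (f : MvPolynomial σ K) :
    h.proj k (f • m) ∈ (stdGrading K σ (k - j)).map (smulMap K σ m) := by
  induction f using MvPolynomial.induction_on' with
  | monomial s a =>
    have hs : monomial s a ∈ stdGrading K σ s.degree :=
      isWeightedHomogeneous_monomial _ _ _ (weight_one_eq s)
    by_cases hk : (s.degree : ℤ) + j = k
    · rw [h.proj_of_mem (hk ▸ h.smul_mem _ _ _ _ hs hm)]
      refine ⟨monomial s a, ?_, rfl⟩
      rwa [← hk, add_sub_cancel_right]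
    · rw [h.proj_of_mem_ne (h.smul_mem _ _ _ _ hs hm) hk]
      exact zero_mem _
  | add p q hp hq =>
    rw [add_smul, map_add]
    exact add_mem hp hq

-- Finitely many homogeneous components of generators suffice, so the piece of degree k is covered
-- by finitely many images of the finite-dimensional spaces S_(k-j).
include h in
lemma IsGrading.finite [Fintype σ] [Module.Finite (MvPolynomial σ K) M] (k : ℤ) :
    Module.Finite K (ℳ k) := by
  classical
  obtain ⟨G, hG⟩ := Module.Finite.fg_top (R := MvPolynomial σ K) (M := M)
  choose J hJ using h.exists_eq_sum
  let I := G.biUnion J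
  let V : Submodule K M := ⨆ x : (G ×ˢ I : Finset (M × ℤ)),
    (stdGrading K σ (k - x.1.2)).map (smulMap K σ (h.proj x.1.2 x.1.1))
  have hV : Module.Finite K V := Submodule.finite_iSup _
  have hle : ℳ k ≤ V := by
    intro m hm
    have hmem : m ∈ Submodule.span (MvPolynomial σ K) (G : Set M) := hG ▸ Submodule.mem_top
    obtain ⟨f, -, rfl⟩ := Submodule.mem_span_finset.1 hmem
    rw [← h.proj_of_mem hm, map_sum]
    refine sum_mem fun g hg => ?_
    have hfg : f g • g = ∑ j ∈ I, f g • h.proj j g := by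
      rw [← Finset.smul_sum, ← hJ g I (Finset.subset_biUnion_of_mem J hg)]
    rw [hfg, map_sum]
    refine sum_mem fun j hj => ?_
    exact Submodule.mem_iSup_of_mem (⟨(g, j), Finset.mem_product.2 ⟨hg, hj⟩⟩ :
      (G ×ˢ I : Finset (M × ℤ))) (h.proj_smul_mem (h.proj_mem j g) (f g))
  exact Submodule.finiteDimensional_of_le hle

include h in
lemma IsGrading.negPow_mul_mem_nonnegSeries [Fintype σ] [Module.Finite (MvPolynomial σ K) M]
    {φ : PowerSeries ℤ} (hφ : ∀ k : ℕ, (Module.finrank K (ℳ k) : ℤ) = PowerSeries.coeff k φ)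
    (hneg : ∀ k < 0, Module.finrank K (ℳ k) = 0) {rs : List (MvPolynomial σ K)}
    (hI : ∀ f ∈ rs, f ∈ Ideal.span (Set.range (X : σ → MvPolynomial σ K)))
    (hreg : RingTheory.Sequence.IsWeaklyRegular M rs) :
    negPow (-rs.length) * φ ∈ nonnegSeries := by
  have hp : IsProjectionFamily (σ := σ) K h.proj := by
    refine ⟨fun k m => h.proj_of_mem (h.proj_mem k m), fun v k m => ?_, fun k => ?_⟩
    · rw [add_comm]
      exact h.proj_smul (isWeightedHomogeneous_X K _ v) k m
    · rw [h.range_proj]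
      exact h.finite k
  have hf : ∀ k, hilbertFun h.proj k = Module.finrank K (ℳ k) := fun k => by
    rw [hilbertFun, h.range_proj]
  have hφ' : φ = PowerSeries.mk fun k : ℕ => hilbertFun h.proj k := by
    ext k
    rw [PowerSeries.coeff_mk, hf, hφ]
  intro k
  rw [hφ', ← mk_diff_iterate _ _ (fun k hk => by rw [hf, hneg k hk]; rfl), PowerSeries.coeff_mk]
  exact hp.diff_iterate_nonneg ⟨rs, hI, hreg, rfl⟩ k

end grading

/-! ### Gradings and regular sequences on the building blocks -/

section criterion

variable {K : Type*} [Field K] {M : Type*} [AddCommGroup M] [Module K M]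

lemma isInternal_of_projections {ℳ : ℤ → Submodule K M} (p : ℤ → M →ₗ[K] M)
    (hmem : ∀ k m, p k m ∈ ℳ k) (hself : ∀ k, ∀ m ∈ ℳ k, p k m = m)
    (hne : ∀ j k, j ≠ k → ∀ m ∈ ℳ j, p k m = 0)
    (hsum : ∀ m, ∃ J : Finset ℤ, m = ∑ j ∈ J, p j m) : DirectSum.IsInternal ℳ := by
  rw [DirectSum.isInternal_submodule_iff_iSupIndep_and_iSup_eq_top]
  constructor
  · intro k
    rw [Submodule.disjoint_def]
    intro m hm hm'
    have hle : ⨆ j, ⨆ (_ : j ≠ k), ℳ j ≤ LinearMap.ker (p k) :=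
      iSup₂_le fun j hj m hm => hne j k hj m hm
    rw [← hself k m hm]
    exact hle hm'
  · rw [eq_top_iff]
    intro m _
    obtain ⟨J, hJ⟩ := hsum m
    rw [hJ]
    exact sum_mem fun j _ => Submodule.mem_iSup_of_mem j (hmem j m)

lemma isInternal_stdGrading (K : Type u) [Field K] (τ : Type) [Fintype τ] [DecidableEq τ] (s : ℤ) :
    DirectSum.IsInternal fun k => stdGrading K τ (k - s) := by
  refine isInternal_of_projections
    (fun k => weightedHomogeneousComponent (fun _ : τ => (1 : ℤ)) (k - s)) ?_ ?_ ?_ ?_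
  · intro k m
    exact weightedHomogeneousComponent_mem _ _ _
  · intro k m hm
    exact IsWeightedHomogeneous.weightedHomogeneousComponent_same hm
  · intro j k hjk m hm
    exact IsWeightedHomogeneous.weightedHomogeneousComponent_ne _ hm (by omega)
  · intro m
    refine ⟨m.support.image fun d => (d.degree : ℤ) + s, ?_⟩
    ext d
    rw [coeff_sum]
    simp only [coeff_weightedHomogeneousComponent, weight_one_eq]
    by_cases hd : d ∈ m.support
    · rw [Finset.sum_eq_single_of_mem _ (Finset.mem_image_of_mem _ hd)]
      · simp
      · intro k _ hk
        rw [if_neg (by omega)]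
    · rw [notMem_support_iff.1 hd]
      simp

end criterion

section regular

open RingTheory.Sequence

lemma isRegular_X_map {K : Type*} [Field K] {τ : Type*} {l : List τ} (hl : l.Nodup) :
    IsRegular (MvPolynomial τ K) (l.map X : List (MvPolynomial τ K)) := by
  have hspan : ∀ l' : List τ, (Ideal.ofList (l'.map X : List (MvPolynomial τ K))) =
      Ideal.span (X '' {v | v ∈ l'}) := by
    intro l'
    rw [Ideal.ofList]
    congr 1
    ext
    simp
  refine ⟨⟨fun i hi => ?_⟩, ?_⟩
  · rw [isSMulRegular_quotient_iff_mem_of_smul_mem]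
    intro f hf
    rw [List.length_map] at hi
    rw [← List.map_take, smul_eq_mul, Ideal.mul_top, hspan, mem_ideal_span_X_image] at hf ⊢
    intro m hm
    -- Some earlier variable divides the monomial m times the i-th variable; it is a different
    -- variable, as the list has no repetition, so it divides m.
    obtain ⟨v, hv, hv'⟩ := hf (m + Finsupp.single l[i] 1) (by
      rw [List.getElem_map, smul_eq_mul, mem_support_iff, add_comm m, mul_comm,
        add_comm, coeff_mul_X]
      exact mem_support_iff.1 hm)
    refine ⟨v, hv, ?_⟩
    have hne : l[i] ≠ v := by
      rintro rfl
      obtain ⟨j, hj, hji⟩ := List.mem_take_iff_getElem.1 hv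
      have := (List.Nodup.getElem_inj_iff hl).1 hji
      omega
    simpa [Finsupp.single_apply, hne] using hv'
  · intro htop
    have : (1 : MvPolynomial τ K) ∈ Ideal.span (X '' {v | v ∈ l} : Set (MvPolynomial τ K)) := by
      rw [← hspan]
      have h1 : (1 : MvPolynomial τ K) ∈ (⊤ : Ideal (MvPolynomial τ K)) := trivial
      rw [htop] at h1
      simpa using h1
    rw [mem_ideal_span_X_image] at this
    obtain ⟨v, -, hv⟩ := this 0 (by simp)
    exact hv rfl

/-- The quotients of a product by an element. -/
noncomputable def quotSMulTopProd {R : Type*} [CommRing R] (x : R) (M N : Type*) [AddCommGroup M]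
    [Module R M] [AddCommGroup N] [Module R N] :
    QuotSMulTop x (M × N) ≃ₗ[R] QuotSMulTop x M × QuotSMulTop x N :=
  LinearEquiv.ofBijective (((QuotSMulTop.map x (LinearMap.fst R M N))).prod
    (QuotSMulTop.map x (LinearMap.snd R M N))) <| by
  constructor
  · rw [← LinearMap.ker_eq_bot, eq_bot_iff]
    intro z hz
    obtain ⟨⟨m, n⟩, rfl⟩ := Submodule.Quotient.mk_surjective _ z
    have hz' := LinearMap.mem_ker.1 hz
    have h1 := congrArg Prod.fst hz'
    have h2 := congrArg Prod.snd hz'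
    obtain ⟨m', rfl⟩ := mem_smul_top_iff.1 ((Submodule.Quotient.mk_eq_zero _).1 h1)
    obtain ⟨n', rfl⟩ := mem_smul_top_iff.1 ((Submodule.Quotient.mk_eq_zero _).1 h2)
    exact (Submodule.Quotient.mk_eq_zero _).2 (mem_smul_top_iff.2 ⟨(m', n'), rfl⟩)
  · rintro ⟨a, b⟩
    obtain ⟨m, rfl⟩ := Submodule.Quotient.mk_surjective _ a
    obtain ⟨n, rfl⟩ := Submodule.Quotient.mk_surjective _ b
    exact ⟨Submodule.Quotient.mk (m, n), rfl⟩

lemma isWeaklyRegular_prod {R : Type*} [CommRing R] {M N : Type*} [AddCommGroup M]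
    [Module R M] [AddCommGroup N] [Module R N] {rs : List R} (hM : IsWeaklyRegular M rs)
    (hN : IsWeaklyRegular N rs) : IsWeaklyRegular (M × N) rs := by
  induction rs generalizing M N with
  | nil => simp
  | cons x rs ih =>
    rw [isWeaklyRegular_cons_iff] at hM hN ⊢
    refine ⟨fun a b hab => ?_, ((quotSMulTopProd x M N).isWeaklyRegular_congr rs).2 (ih hM.2 hN.2)⟩
    exact Prod.ext (hM.1 (congrArg Prod.fst hab)) (hN.1 (congrArg Prod.snd hab))

lemma top_ne_smul_of_surjective {R : Type*} [CommRing R] {M N : Type*} [AddCommGroup M]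
    [Module R M] [AddCommGroup N] [Module R N] {I : Ideal R} (f : M →ₗ[R] N)
    (hf : Function.Surjective f) (hN : (⊤ : Submodule R N) ≠ I • ⊤) :
    (⊤ : Submodule R M) ≠ I • ⊤ := by
  intro h
  apply hN
  have := congrArg (Submodule.map f) h
  rwa [Submodule.map_smul'', Submodule.map_top, LinearMap.range_eq_top.2 hf] at this

end regular

/-! ### Realizing decomposable series by modules -/

/-- The series `φ` is the Hilbert series of a finitely generated graded module on which `rs` is a
weakly regular sequence, regular unless `φ = 0`. -/
def IsRealizable {K : Type u} [Field K] {σ : Type} (rs : List (MvPolynomial σ K))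
    (φ : PowerSeries ℤ) : Prop :=
  ∃ (N : Type u) (_ : AddCommGroup N) (_ : Module K N) (_ : Module (MvPolynomial σ K) N)
    (_ : IsScalarTower K (MvPolynomial σ K) N) (𝒩 : ℤ → Submodule K N),
    Module.Finite (MvPolynomial σ K) N ∧ IsGrading (σ := σ) 𝒩 ∧
    (∀ k < 0, Module.finrank K (𝒩 k) = 0) ∧
    (∀ k : ℕ, (Module.finrank K (𝒩 k) : ℤ) = PowerSeries.coeff k φ) ∧
    RingTheory.Sequence.IsWeaklyRegular N rs ∧ (φ ≠ 0 → RingTheory.Sequence.IsRegular N rs)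

section realize

variable {K : Type u} [Field K] {σ : Type} {rs : List (MvPolynomial σ K)}

lemma isRealizable_zero : IsRealizable rs 0 := by
  refine ⟨PUnit, inferInstance, inferInstance, inferInstance, inferInstance, fun _ => ⊤,
    inferInstance, ⟨?_, fun _ _ _ _ _ _ => trivial⟩, ?_, ?_, ?_, fun h => (h rfl).elim⟩
  · exact isInternal_of_projections (fun _ => 0) (fun _ _ => trivial) (fun _ _ _ => rfl)
      (fun _ _ _ _ _ => rfl) (fun m => ⟨∅, rfl⟩)
  · intro k _
    exact Module.finrank_zero_of_subsingleton
  · intro k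
    rw [Module.finrank_zero_of_subsingleton]
    simp
  · have : ∀ rs : List (MvPolynomial σ K), ∀ (N : Type u) [AddCommGroup N]
        [Module (MvPolynomial σ K) N] [Subsingleton N],
        RingTheory.Sequence.IsWeaklyRegular N rs := by
      intro rs
      induction rs with
      | nil => intros; simp
      | cons x rs ih =>
        intro N _ _ _
        rw [RingTheory.Sequence.isWeaklyRegular_cons_iff]
        exact ⟨fun _ _ _ => Subsingleton.elim _ _, ih _⟩
    exact this rs PUnit

lemma IsRealizable.add [Fintype σ] {φ ψ : PowerSeries ℤ}
    (hφ : IsRealizable rs φ) (hψ : IsRealizable rs ψ) :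
    IsRealizable rs (φ + ψ) := by
  obtain ⟨M, _, _, _, _, ℳ, hM1, hM2, hM3, hM4, hM5, hM6⟩ := hφ
  obtain ⟨N, _, _, _, _, 𝒩, hN1, hN2, hN3, hN4, hN5, hN6⟩ := hψ
  have hfin : ∀ k, Module.finrank K ((ℳ k).prod (𝒩 k)) =
      Module.finrank K (ℳ k) + Module.finrank K (𝒩 k) := by
    intro k
    have := hM2.finite k
    have := hN2.finite k
    rw [← Module.finrank_prod]
    exact LinearEquiv.finrank_eq
      { toFun := fun x => (⟨x.1.1, x.2.1⟩, ⟨x.1.2, x.2.2⟩)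
        map_add' := fun _ _ => rfl
        map_smul' := fun _ _ => rfl
        invFun := fun x => ⟨(x.1.1, x.2.1), x.1.2, x.2.2⟩
        left_inv := fun _ => rfl
        right_inv := fun _ => rfl }
  refine ⟨M × N, inferInstance, inferInstance, inferInstance, inferInstance,
    fun k => (ℳ k).prod (𝒩 k), inferInstance, ⟨?_, ?_⟩, ?_, ?_, isWeaklyRegular_prod hM5 hN5, ?_⟩
  · refine isInternal_of_projections (fun k => (hM2.proj k).prodMap (hN2.proj k)) ?_ ?_ ?_ ?_
    · exact fun k m => ⟨hM2.proj_mem k m.1, hN2.proj_mem k m.2⟩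
    · exact fun k m hm => Prod.ext (hM2.proj_of_mem hm.1) (hN2.proj_of_mem hm.2)
    · exact fun j k hjk m hm => Prod.ext (hM2.proj_of_mem_ne hm.1 hjk) (hN2.proj_of_mem_ne hm.2 hjk)
    · rintro ⟨m, n⟩
      obtain ⟨J, hJ⟩ := hM2.exists_eq_sum m
      obtain ⟨I, hI⟩ := hN2.exists_eq_sum n
      refine ⟨J ∪ I, Prod.ext ?_ ?_⟩
      · rw [Prod.fst_sum]
        exact hJ _ Finset.subset_union_left
      · rw [Prod.snd_sum]
        exact hI _ Finset.subset_union_right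
  · exact fun i j f m hf hm => ⟨hM2.smul_mem i j f _ hf hm.1, hN2.smul_mem i j f _ hf hm.2⟩
  · intro k hk
    rw [hfin, hM3 k hk, hN3 k hk]
  · intro k
    rw [hfin, map_add, ← hM4, ← hN4]
    push_cast
    rfl
  · intro hne
    refine ⟨isWeaklyRegular_prod hM5 hN5, ?_⟩
    by_cases h : φ = 0
    · have hψ : ψ ≠ 0 := by
        rintro rfl
        exact hne (by simp [h])
      exact top_ne_smul_of_surjective (LinearMap.snd _ M N) LinearMap.snd_surjective (hN6 hψ).2
    · exact top_ne_smul_of_surjective (LinearMap.fst _ M N) LinearMap.fst_surjective (hM6 h).2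

variable [Fintype σ]

/-- The first `d` variables. -/
noncomputable def initialVars (K : Type u) [Field K] (e : σ ≃ Fin (Fintype.card σ)) {d : ℕ}
    (hd : d ≤ Fintype.card σ) : List (MvPolynomial σ K) :=
  (List.finRange d).map fun i => X (e.symm (Fin.castLE hd i))

/-- The projection of `K[x_1,…,x_N]` on the polynomial ring in the first `q` variables. -/
noncomputable def truncVars (K : Type u) [Field K] (e : σ ≃ Fin (Fintype.card σ)) (q : ℕ) :
    MvPolynomial σ K →ₐ[K] MvPolynomial (Fin q) K :=
  aeval fun v => if h : (e v : ℕ) < q then X ⟨e v, h⟩ else 0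

lemma truncVars_X (e : σ ≃ Fin (Fintype.card σ)) {q : ℕ} (hq : q ≤ Fintype.card σ) (i : Fin q) :
    truncVars K e q (X (e.symm (Fin.castLE hq i))) = X i := by
  simp [truncVars]

lemma truncVars_mem (e : σ ≃ Fin (Fintype.card σ)) {q : ℕ} {i : ℤ} {f : MvPolynomial σ K}
    (hf : f ∈ stdGrading K σ i) : truncVars K e q f ∈ stdGrading K (Fin q) i := by
  rw [← f.support_sum_monomial_coeff, map_sum]
  refine sum_mem fun m hm => ?_
  rw [truncVars, aeval_monomial, ← mem_stdGrading.1 hf m hm]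
  rw [← zero_add (m.degree : ℤ), ← weight_one_eq, Finsupp.weight_apply]
  refine IsWeightedHomogeneous.mul (isWeightedHomogeneous_C _ _) ?_
  refine IsWeightedHomogeneous.prod _ _ _ fun v _ => IsWeightedHomogeneous.pow ?_ _
  split_ifs
  · exact isWeightedHomogeneous_X K _ _
  · exact isWeightedHomogeneous_zero K _ _

/-- The module is the polynomial ring in the first q variables, the others acting as zero, generated
in degree s; since d ≤ q, the first d variables remain regular. -/
lemma isRealizable_monomial (e : σ ≃ Fin (Fintype.card σ)) {d q : ℕ} (hdq : d ≤ q)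
    (hq : q ≤ Fintype.card σ) (s : ℕ) :
    IsRealizable (initialVars K e (hdq.trans hq)) (PowerSeries.X ^ s * negPow q) := by
  let θ := truncVars K e q
  let _ : Algebra (MvPolynomial σ K) (MvPolynomial (Fin q) K) := θ.toRingHom.toAlgebra
  have hsmul : ∀ (f : MvPolynomial σ K) (g : MvPolynomial (Fin q) K), f • g = θ f * g :=
    fun _ _ => rfl
  have hST : IsScalarTower K (MvPolynomial σ K) (MvPolynomial (Fin q) K) :=
    IsScalarTower.of_algebraMap_eq fun c => (θ.commutes c).symm
  have hreg : RingTheory.Sequence.IsRegular (MvPolynomial (Fin q) K)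
      (initialVars K e (hdq.trans hq)) := by
    have h := isRegular_X_map (K := K) (l := (List.finRange d).map (Fin.castLE hdq))
      ((List.nodup_finRange d).map (Fin.castLE_injective hdq))
    refine ((AddEquiv.refl _).isRegular_congr ?_).1 h
    rw [initialVars, List.map_map, List.forall₂_map_left_iff, List.forall₂_map_right_iff,
      List.forall₂_same]
    intro i _ g
    change X (Fin.castLE hdq i) * g = θ _ * g
    rw [← truncVars_X e hq]
    rfl
  refine ⟨MvPolynomial (Fin q) K, inferInstance, inferInstance, inferInstance, hST,
    fun k => stdGrading K (Fin q) (k - s), ?_, ⟨isInternal_stdGrading K (Fin q) s, ?_⟩, ?_, ?_,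
    hreg.toIsWeaklyRegular, fun _ => hreg⟩
  · have hsurj : Function.Surjective θ := by
      rw [← AlgHom.range_eq_top, eq_top_iff, ← MvPolynomial.adjoin_range_X, Algebra.adjoin_le_iff]
      rintro _ ⟨i, rfl⟩
      exact ⟨_, truncVars_X e hq i⟩
    exact Module.Finite.of_surjective (Algebra.linearMap (MvPolynomial σ K) (MvPolynomial (Fin q) K))
      hsurj
  · intro i j f m hf hm
    rw [hsmul, add_sub_assoc]
    exact IsWeightedHomogeneous.mul (truncVars_mem e hf) hm
  · intro k hk
    beta_reduce
    rw [stdGrading_of_neg (by omega), finrank_bot]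
  · intro k
    beta_reduce
    rw [PowerSeries.coeff_X_pow_mul']
    split_ifs with hks
    · rw [← Nat.cast_sub hks, finrank_stdGrading, Fintype.card_fin]
    · rw [stdGrading_of_neg (by omega), finrank_bot, Nat.cast_zero]

lemma isRealizable_of_decomposable (e : σ ≃ Fin (Fintype.card σ)) {d : ℕ}
    (hd : d ≤ Fintype.card σ) {φ : PowerSeries ℤ}
    (h : negPow (-d) * φ ∈ decomposable (Fintype.card σ - d)) :
    IsRealizable (initialVars K e hd) φ := by
  have key : ∀ ψ ∈ decomposable (Fintype.card σ - d),
      IsRealizable (initialVars K e hd) (negPow d * ψ) := by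
    intro ψ hψ
    induction hψ using AddSubmonoid.closure_induction with
    | mem x hx =>
      obtain ⟨s, j, hj, rfl⟩ := hx
      rw [mul_left_comm, ← negPow_add]
      exact_mod_cast isRealizable_monomial e (Nat.le_add_right d j) (by omega) s
    | zero =>
      rw [mul_zero]
      exact isRealizable_zero
    | add x y _ _ hx hy =>
      rw [mul_add]
      exact hx.add hy
  have := key _ h
  rwa [← mul_assoc, ← negPow_add, add_neg_cancel, negPow_zero, one_mul] at this

end realize

/-! ### Hilbert depth from the series, and the conclusion -/

section hdepth

variable {K : Type u} [Field K] {σ : Type} [Fintype σ] {M : Type u} [AddCommGroup M] [Module K M]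
  {ℳ : ℤ → Submodule K M} {φ : PowerSeries ℤ}

/-- The Hilbert depth is the largest `h` for which `(1 - X)^h φ` has nonnegative coefficients, where
`φ` is the Hilbert series, provided that `(1 - X)^h φ` is decomposable. -/
theorem hdepth_eq_of_isGreatest (hℳ : ∀ k : ℕ, (Module.finrank K (ℳ k) : ℤ) = PowerSeries.coeff k φ)
    (hneg : ∀ k < 0, Module.finrank K (ℳ k) = 0) (hφ : φ ≠ 0) {h : ℕ}
    (hle : h ≤ Fintype.card σ)
    (hdec : negPow (-h) * φ ∈ decomposable (Fintype.card σ - h))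
    (hmax : ∀ d : ℕ, negPow (-d) * φ ∈ nonnegSeries → d ≤ h) :
    hdepth σ ℳ = h := by
  apply le_antisymm
  · refine sSup_le ?_
    rintro _ ⟨N, _, _, _, _, 𝒩, hfin, hgr, hdim, rfl⟩
    refine iSup₂_le fun rs hrs => ?_
    exact_mod_cast hmax rs.length (hgr.negPow_mul_mem_nonnegSeries
      (fun k => by rw [hdim, hℳ]) (fun k hk => by rw [hdim, hneg k hk]) hrs.1
      hrs.2.toIsWeaklyRegular)
  · obtain ⟨N, i1, i2, i3, i4, 𝒩, hfin, hgr, hneg', hdim, -, hreg⟩ :=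
      isRealizable_of_decomposable (K := K) (Fintype.equivFin σ) hle hdec
    refine le_trans ?_ (le_sSup ⟨N, i1, i2, i3, i4, 𝒩, hfin, hgr, ?_, rfl⟩)
    · refine le_trans ?_ (le_iSup₂ (initialVars K (Fintype.equivFin σ) hle) ⟨?_, hreg hφ⟩)
      · simp [initialVars]
      · intro f hf
        obtain ⟨i, -, rfl⟩ := List.mem_map.1 hf
        exact Ideal.subset_span ⟨_, rfl⟩
    · intro k
      rcases lt_or_ge k 0 with hk | hk
      · rw [hneg' k hk, hneg k hk]
      · lift k to ℕ using hk
        exact_mod_cast (hdim k).trans (hℳ k).symm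

end hdepth

/-- With P the nonnegativity of all coefficients and Q its finite check, the maximum for P is also
that of the restricted set: its lower bound costs nothing, because `lo` itself satisfies P. -/
lemma exists_isGreatest_of_bounds {P : ℕ → Prop} {Q : ℕ → Prop} {lo up : ℕ} (hlo : P lo)
    (hup : ∀ d, P d → d ≤ up) (hPQ : ∀ d ≤ up, Q d → P d) (hQP : ∀ d, P d → Q d) :
    ∃ h, P h ∧ (∀ d, P d → d ≤ h) ∧ IsGreatest {d | lo ≤ d ∧ d ≤ up ∧ Q d} h := by
  classical
  have hmem := Nat.findGreatest_spec (P := P) (hup lo hlo) hlo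
  have hmax : ∀ d, P d → d ≤ Nat.findGreatest P up := fun d hd => Nat.le_findGreatest (hup d hd) hd
  exact ⟨_, hmem, hmax, ⟨hmax lo hlo, hup _ hmem, hQP _ hmem⟩,
    fun d hd => hmax d (hPQ d hd.2.1 hd.2.2)⟩

end HilbertDepth

open HilbertDepth in
theorem proposition3p8 {K : Type u} [Field K] {r : ℕ} [NeZero r] (n : Fin r → ℕ)
    (hn : ∀ i, 1 ≤ n i) :
    (∃ h : ℕ,
      HilbertDepth.hdepth (Σ i : Fin r, Fin (n i))
        (HilbertDepth.idealGrading (HilbertDepth.blockIdeal K n)) = (h : ℕ∞) ∧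
      IsGreatest {d : ℕ |
        ∑ i, ⌈(n i : ℚ) / 2⌉₊ ≤ d ∧ d ≤ ⌊((∑ i, (n i : ℚ)) + r) / 2⌋₊ ∧
        ∀ k : ℕ, r ≤ k → k ≤ d → 0 ≤ HilbertDepth.idealSum n d k} h) ∧
    (∃ h : ℕ,
      HilbertDepth.hdepth (Σ i : Fin r, Fin (n i))
        (HilbertDepth.quotientGrading (HilbertDepth.blockIdeal K n)) = (h : ℕ∞) ∧
      IsGreatest {d : ℕ |
        (∑ i, ⌈(n i : ℚ) / 2⌉₊) - Finset.univ.inf' Finset.univ_nonempty (fun i => ⌈(n i : ℚ) / 2⌉₊)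
          ≤ d ∧
        d ≤ (∑ i, n i) - Finset.univ.inf' Finset.univ_nonempty n ∧
        ∀ k : ℕ, r ≤ k → k ≤ d → 0 ≤ HilbertDepth.quotientSum n d k} h) := by
  have hcard : Fintype.card (Σ i : Fin r, Fin (n i)) = ∑ i, n i := by simp
  have hrN : r ≤ ∑ i, n i := by
    simpa using Finset.sum_le_sum fun i (_ : i ∈ Finset.univ) => hn i
  have hfloor : ⌊((∑ i, (n i : ℚ)) + r) / 2⌋₊ = (∑ i, n i + r) / 2 := by
    rw [← floor_half]
    push_cast
    rfl
  simp only [ceil_half, hfloor]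
  constructor
  · have hdec : ∀ d ≤ (∑ i, n i + r) / 2, (∀ k : ℕ, r ≤ k → k ≤ d → 0 ≤ idealSum n d k) →
        negPow (-d) * idealSeries n ∈ decomposable (∑ i, n i - d) := fun d hd h =>
      decomposable_idealSeries n (by omega) fun k hk => by
        rcases lt_or_ge k r with hkr | hkr
        · exact (idealSum_eq_zero n hkr).ge
        · exact h k hkr hk
    obtain ⟨h, hmem, hmax, hgreat⟩ := exists_isGreatest_of_bounds
      (P := fun d : ℕ => negPow (-d) * idealSeries n ∈ nonnegSeries)
      (idealSeries_nonneg n) (fun d => le_of_idealSeries_nonneg n hn)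
      (fun d hd hQ => decomposable_le _ (hdec d hd hQ))
      (fun d hd k _ _ => by rw [← coeff_negPow_mul_idealSeries]; exact hd k)
    refine ⟨h, hdepth_eq_of_isGreatest (finrank_idealGrading_blockIdeal n)
      (fun k hk => finrank_idealGrading_of_neg _ hk) ?_ ?_ ?_ hmax, hgreat⟩
    -- The zero series would be nonnegative for every d, against the upper bound.
    · intro h0
      have := le_of_idealSeries_nonneg n hn (d := (∑ i, n i + r) / 2 + 1) (by rw [h0]; simp)
      omega
    · have := hgreat.1.2.1
      omega
    · rw [hcard]
      exact hdec h hgreat.1.2.1 hgreat.1.2.2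
  -- The block set aside in the lower bound is one of minimal rounded-up half.
  · obtain ⟨j, -, hj⟩ := Finset.exists_mem_eq_inf' Finset.univ_nonempty (fun i => (n i + 1) / 2)
    have hdec : ∀ d ≤ ∑ i, n i - Finset.univ.inf' Finset.univ_nonempty n,
        (∀ k : ℕ, r ≤ k → k ≤ d → 0 ≤ quotientSum n d k) →
        negPow (-d) * quotientSeries n ∈ decomposable (∑ i, n i - d) := fun d hd h =>
      decomposable_quotientSeries n (by omega) fun k hk => by
        rcases lt_or_ge k r with hkr | hkr
        · exact quotientSum_nonneg_of_lt n (by omega) hkr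
        · exact h k hkr hk
    have hup : ∀ d : ℕ, negPow (-d) * quotientSeries n ∈ nonnegSeries →
        d ≤ ∑ i, n i - Finset.univ.inf' Finset.univ_nonempty n := fun d =>
      le_of_quotientSeries_nonneg n fun i => Finset.inf'_le n (Finset.mem_univ i)
    obtain ⟨h, hmem, hmax, hgreat⟩ := exists_isGreatest_of_bounds
      (P := fun d : ℕ => negPow (-d) * quotientSeries n ∈ nonnegSeries)
      (quotientSeries_nonneg n j (hn j)) hup
      (fun d hd hQ => decomposable_le _ (hdec d hd hQ))
      (fun d hd k _ _ => by rw [← coeff_negPow_mul_quotientSeries]; exact hd k)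
    rw [hj]
    refine ⟨h, hdepth_eq_of_isGreatest (finrank_quotientGrading_blockIdeal n)
      (fun k hk => finrank_quotientGrading_of_neg _ hk) ?_ ?_ ?_ hmax, hgreat⟩
    · intro h0
      have := hup (∑ i, n i + 1) (by rw [h0]; simp)
      omega
    · have := hgreat.1.2.1
      omega
    · rw [hcard]
      exact hdec h hgreat.1.2.1 hgreat.1.2.2
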